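/- **Setting.** Let $\Lambda=\{1,\dots,L\}$, $L\ge 1$, be a chain of $L$ qubits and $H^{(L)}=\sum_{X\subseteq\Lambda}h_X$ a Hamiltonian, with $h_X$ Hermitian and acting on the sites $X$, such that $\sum_{X\ni j}\|h_X\|\le g$ for every $j\in\Lambda$ ($\|\cdot\|$ is the operator norm), $h_X=0$ if $|X|>k$, and $h_X=0$ if $X$ contains two sites at distance larger than $d_H$; no translation invariance is assumed. For $\tau\ge 0$ put $U^{(L)}=e^{-iH^{(L)}\tau}$. For $\ell\ge 0$ let $\Lambda_{\ell,j}=\{j'\in\Lambda:|j-j'|\le \ell/2\}$ and $H^{(\ell,j)}=\sum_{X\subseteq\Lambda_{\ell,j}}h_X$. Let $V^{(2)}_{a,a+1}(\cdot)$ be arbitrary parametrized two-qubit unitary gates on neighboring sites, and let $$V^{(L)}(\theta)=\prod_{i=1}^d\Big[\Big(\prod_k V^{(2)}_{2k,2k+1}(\theta_{i,k})\Big)\Big(\prod_k V^{(2)}_{2k-1,2k}(\theta'_{i,k})\Big)\Big]$$ be the brickwork ansatz of depth $d$ on $\Lambda$ (all gates supported in $\Lambda$). Let $V^{(\tilde L,j)}(\theta)$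 be the same product restricted to the gates supported in $\Lambda_{\tilde L,j}$, as an operator on the qubits of $\Lambda_{\tilde L,j}$. For operators $U,V$ on the qubits of a finite set $S$ of sites, let $|\Phi_+\rangle_{AB}=\bigotimes_{j\in S}\frac{1}{\sqrt2}(|00\rangle+|11\rangle)_{A_jB_j}$ on two copies $A,B$ of the system, $\rho_{AB}(U,V)=(U_A\otimes V_B^*)|\Phi_+\rangle\langle\Phi_+|(U_A\otimes V_B^*)^\dagger$, let $\Pi_j$ be the projection onto the Bell pair of $A_j,B_j$, and define $$C^{(j)}_{\rm LHST}(U,V)=1-\mathrm{Tr}[\Pi_j\rho_{AB}(U,V)],\qquad C_{\rm LHST}(U,V)=\frac1{|S|}\sum_{j\in S}C^{(j)}_{\rm LHST}(U,V),$$ $$C_{\rm HST}(U,V)=1-4^{-|S|}\,|\mathrm{Tr}[U^\dagger V]|^2,\qquad \bar F(U,V)=\int|\langle\psi|U^\dagger V|\psi\rangle|^2\,d\psi,$$ the last integral being over Haar random unit vectors $\psi$. **Theorem.** For all $g\ge0$, $k\in\mathbb N$, $d_H\ge 0$ there are a velocity $v>0$ and a length $\xi>0$ depending only on $g,k,d_H$,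 and for every $\tau\ge0$ there are constants $C,C'>0$ depending only on $g,k,d_H,\tau$, such that the following holds for every $L\geq 1$ and every Hamiltonian as above. (a) The Lieb–Robinson bound $\|[U^{(L)\dagger}O_jU^{(L)},O_{j'}]\|\le C\,e^{-(|j-j'|-v\tau)/\xi}$ holds for all Hermitian single-site operators $O_j,O_{j'}$ of norm $1$ at sites $j,j'$. (b) For every $l_0\ge0$, with $L'=2(l_0+d_H+v\tau)$ and $$\varepsilon_{\rm LR}=C'\int_{L'/2-d_H}^\infty e^{-(x-v\tau)/\xi}\,dx ,$$ one has $\|U^{(L)\dagger}O_jU^{(L)}-e^{iH^{(L',j)}\tau}O_je^{-iH^{(L',j)}\tau}\|\le\varepsilon_{\rm LR}$ for every site $j$ and every Hermitian operator $O_j$ at $j$ of norm $1$. (c) Let moreover $d=L'/4+d'$ with $d\in\mathbb{N}$ and $d'\ge0$ be the depth of the ansatz, let $\tilde L$ be an integer with $\tilde L\ge L'+2d'+1$, let $\tilde U^{(L',j)}=e^{-iH^{(L',j)}\tau}\otimes I_{\Lambda_{\tilde L,j}\setminus\Lambda_{L',j}}$, and define the local-compilation cost $$C^{(\tilde L)}(\theta)=\frac1L\sum_{j=1}^L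 C^{(j)}_{\rm LHST}\big(\tilde U^{(L',j)},V^{(\tilde L,j)}(\theta)\big).$$ If a parameter set $\theta_{\rm opt}$ satisfies $C^{(\tilde L)}(\theta_{\rm opt})\le\varepsilon_{\rm LHST}$, then $$C_{\rm LHST}(U^{(L)},V^{(L)}(\theta_{\rm opt}))\le\varepsilon_{\rm LHST}+\tfrac34\varepsilon_{\rm LR},$$ $$C_{\rm HST}(U^{(L)},V^{(L)}(\theta_{\rm opt}))\le L\big(\varepsilon_{\rm LHST}+\tfrac34\varepsilon_{\rm LR}\big),$$ $$\bar F(U^{(L)},V^{(L)}(\theta_{\rm opt}))\ge 1-\frac{2^L}{2^L+1}\,L\big(\varepsilon_{\rm LHST}+\tfrac34\varepsilon_{\rm LR}\big).$$ -/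

import Mathlib

open scoped Matrix.Norms.L2Operator Kronecker

noncomputable section

namespace LocalCompilation

/-- Basis states `|s⟩`, `s ∈ {0,1}^S`, of the qubits sitting on a finite set `S` of sites. -/
abbrev Config (S : Finset ℕ) : Type := S → Fin 2

/-- Operators on the Hilbert space `(ℂ²)^{⊗ S}`, written in the computational basis.
`‖A‖` is the operator norm for the Euclidean norm of vectors. -/
abbrev Op (S : Finset ℕ) : Type := Matrix (Config S) (Config S) ℂ

/-- The operator `A ⊗ I_{S \ X}` on `S`, for an operator `A` on `X ⊆ S`. -/
def embed {X S : Finset ℕ} (h : X ⊆ S) (A : Op X) : Op S :=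
  fun s t => if ∀ i : S, (i : ℕ) ∉ X → s i = t i then
    A (fun i => s ⟨i, h i.2⟩) (fun i => t ⟨i, h i.2⟩) else 0

/-! ### Lattice, Hamiltonian, time evolution -/

/-- The one-dimensional lattice `Λ = {1, …, L}`. -/
abbrev lattice (L : ℕ) : Finset ℕ := Finset.Icc 1 L

/-- The distance `|i - j|` of two sites. -/
def siteDist (i j : ℕ) : ℝ := |(i : ℝ) - (j : ℝ)|

/-- The `j`-centered domain of size `ℓ`: the sites `j' ∈ Λ` with `|j - j'| ≤ ℓ / 2`. -/
def domain (L : ℕ) (ℓ : ℝ) (j : ℕ) : Finset ℕ :=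
  open Classical in (lattice L).filter fun j' => siteDist j j' ≤ ℓ / 2

theorem domain_subset (L : ℕ) (ℓ : ℝ) (j : ℕ) : domain L ℓ j ⊆ lattice L := by
  intro i hi
  unfold domain at hi
  exact (Finset.mem_filter.1 hi).1

theorem domain_mono (L : ℕ) {ℓ ℓ' : ℝ} (h : ℓ ≤ ℓ') (j : ℕ) :
    domain L ℓ j ⊆ domain L ℓ' j := by
  intro i hi
  unfold domain at hi ⊢
  rw [Finset.mem_filter] at hi ⊢
  exact ⟨hi.1, hi.2.trans (by linarith)⟩

theorem mem_domain_self {L : ℕ} (n : ℕ) (j : lattice L) : (j : ℕ) ∈ domain L (n : ℝ) j := by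
  unfold domain
  rw [Finset.mem_filter]
  refine ⟨j.2, ?_⟩
  simp only [siteDist, sub_self, abs_zero]
  positivity

/-- `h` (with `h X` an operator on the sites `X`) consists of the terms of a Hamiltonian
`∑_{X ⊆ Λ} h_X` on `Λ` which is extensive with local energy scale `g`, involves at most
`k`-body interactions, and has interaction range `dH`. -/
structure IsLocalHamiltonian (Λ : Finset ℕ) (g : ℝ) (k : ℕ) (dH : ℝ)
    (h : (X : Finset ℕ) → Op X) : Prop where
  hermitian : ∀ X ⊆ Λ, (h X).IsHermitian
  extensive : ∀ j ∈ Λ, ∑ X ∈ Λ.powerset with j ∈ X, ‖h X‖ ≤ g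
  local_terms : ∀ X ⊆ Λ, k < X.card → h X = 0
  finite_range : ∀ X ⊆ Λ, (∃ i ∈ X, ∃ j ∈ X, dH < siteDist i j) → h X = 0

/-- The operator `∑_{X ⊆ S} h_X` on the Hilbert space of `S`. -/
def hamiltonian (h : (X : Finset ℕ) → Op X) (S : Finset ℕ) : Op S :=
  ∑ X ∈ S.powerset.attach, embed (Finset.mem_powerset.1 X.2) (h X)

/-- The time evolution `exp(-i τ ∑_{X ⊆ S} h_X)` on the Hilbert space of `S`. -/
def evolution (h : (X : Finset ℕ) → Op X) (S : Finset ℕ) (τ : ℝ) : Op S :=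
  NormedSpace.exp ((-(Complex.I * (τ : ℂ))) • hamiltonian h S)

/-- `e^{-i H^{(ℓ,j)} τ} ⊗ I` on a region `S` containing the `j`-centered domain of size `ℓ`,
where `H^{(ℓ,j)}` is the restriction of the Hamiltonian to that domain. -/
def restrictedEvolution (h : (X : Finset ℕ) → Op X) (L : ℕ) (ℓ : ℝ) (j : ℕ) (τ : ℝ)
    {S : Finset ℕ} (hS : domain L ℓ j ⊆ S) : Op S :=
  embed hS (evolution h (domain L ℓ j) τ)

/-! ### The brickwork ansatz -/

/-- The gate `A` on the neighboring sites `a, a + 1`, as an operator on `S`, if its support is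
included in `S`; otherwise the gate is left out. -/
def gateOn (S : Finset ℕ) (a : ℕ) (A : Op {a, a + 1}) : Op S :=
  if h : {a, a + 1} ⊆ S then embed h A else 1

/-- The brickwork circuit of depth `d`
`∏_{i=1}^d (∏_k V_{2k,2k+1}(θ_{i,k})) (∏_k V_{2k-1,2k}(θ'_{i,k}))`
in which only the gates with support included in `S ⊆ {1, …, L}` are kept. Here `V a p` is the
two-qubit gate on the sites `a, a + 1` with parameter `p`. For `S = {1, …, L}` this is the full
ansatz. -/
def ansatz {P : Type*} (V : (a : ℕ) → P → Op {a, a + 1}) (L d : ℕ) (θ θ' : Fin d → ℕ → P)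
    (S : Finset ℕ) : Op S :=
  ((List.finRange d).map fun i =>
    ((List.range' 1 L).map fun k => gateOn S (2 * k) (V (2 * k) (θ i k))).prod *
    ((List.range' 1 L).map fun k => gateOn S (2 * k - 1) (V (2 * k - 1) (θ' i k))).prod).prod

/-! ### Cost functions -/

/-- Amplitudes of the Bell pair `(|00⟩ + |11⟩) / √2`. -/
def bellPair (a b : Fin 2) : ℂ := if a = b then 1 / (Real.sqrt 2 : ℂ) else 0

/-- Amplitudes of the state `⨂_{j ∈ S} |Φ₊⟩_{A_j B_j}` on two copies `A`, `B` of `S`. -/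
def bellState (S : Finset ℕ) : Config S × Config S → ℂ :=
  fun x => ∏ j : S, bellPair (x.1 j) (x.2 j)

/-- `ρ_{AB}(U,V) = (U_A ⊗ V*_B) |Φ₊⟩⟨Φ₊| (U_A ⊗ V*_B)†`, with `V*` the entrywise conjugate. -/
def rhoAB {S : Finset ℕ} (U V : Op S) :
    Matrix (Config S × Config S) (Config S × Config S) ℂ :=
  (U ⊗ₖ V.map star) * Matrix.vecMulVec (bellState S) (star (bellState S)) *
    (U ⊗ₖ V.map star).conjTranspose

/-- The projection `Π_j = |Φ₊⟩⟨Φ₊|_{A_j B_j}`, acting as the identity on all other pairs. -/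
def bellProj {S : Finset ℕ} (j : S) :
    Matrix (Config S × Config S) (Config S × Config S) ℂ :=
  fun x y => if ∀ i, i ≠ j → x.1 i = y.1 i ∧ x.2 i = y.2 i then
    bellPair (x.1 j) (x.2 j) * star (bellPair (y.1 j) (y.2 j)) else 0

/-- `C_LHST^{(j)}(U,V) = 1 - Tr[Π_j ρ_{AB}(U,V)]` (the trace is a real number). -/
def costLHSTAt {S : Finset ℕ} (j : S) (U V : Op S) : ℝ :=
  1 - (bellProj j * rhoAB U V).trace.re

/-- `C_LHST(U,V) = (1/|S|) ∑_j C_LHST^{(j)}(U,V)`. -/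
def costLHST {S : Finset ℕ} (U V : Op S) : ℝ :=
  (1 / (S.card : ℝ)) * ∑ j : S, costLHSTAt j U V

/-- `C_HST(U,V) = 1 - |Tr[U† V]|² / 4^{|S|}`. -/
def costHST {S : Finset ℕ} (U V : Op S) : ℝ :=
  1 - ‖(U.conjTranspose * V).trace‖ ^ 2 / 4 ^ S.card

/-- The local-compilation cost `(1/L) ∑_{j=1}^L C_LHST^{(j)}(Ũ^{(L',j)}, V^{(L̃,j)}(θ))`: the
`j`-th term is computed on the Hilbert space of the `j`-centered domain of size `L̃`. -/
def localCompilationCost {P : Type*} (h : (X : Finset ℕ) → Op X) (τ : ℝ)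
    (V : (a : ℕ) → P → Op {a, a + 1}) (L d : ℕ) (θ θ' : Fin d → ℕ → P)
    (L' : ℝ) (Lt : ℕ) (hL : L' ≤ (Lt : ℝ)) : ℝ :=
  (1 / (L : ℝ)) * ∑ j : lattice L,
    costLHSTAt (⟨j, mem_domain_self Lt j⟩ : domain L (Lt : ℝ) j)
      (restrictedEvolution h L L' j τ (domain_mono L hL j))
      (ansatz V L d θ θ' (domain L (Lt : ℝ) j))

/-! ### Average gate fidelity -/

/-- The unit sphere of state vectors on `S`. -/
abbrev StateSphere (S : Finset ℕ) : Type :=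
  Metric.sphere (0 : EuclideanSpace ℂ (Config S)) 1

/-- The law of a Haar random state: the normalized surface measure on the unit sphere. -/
def haarState (S : Finset ℕ) : MeasureTheory.Measure (StateSphere S) :=
  let σ := (MeasureTheory.Measure.addHaar :
    MeasureTheory.Measure (EuclideanSpace ℂ (Config S))).toSphere
  (σ Set.univ)⁻¹ • σ

/-- `F̄(U,V) = ∫ |⟨ψ| U† V |ψ⟩|² dψ` over Haar random states `ψ`. -/
def avgGateFidelity {S : Finset ℕ} (U V : Op S) : ℝ :=
  ∫ ψ : StateSphere S,
    ‖inner ℂ (ψ : EuclideanSpace ℂ (Config S))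
      (Matrix.toEuclideanCLM (𝕜 := ℂ) (U.conjTranspose * V)
        (ψ : EuclideanSpace ℂ (Config S)))‖ ^ 2 ∂(haarState S)

/-! ### The Lieb-Robinson error -/

/-- The operator on `{1, …, L}` given by the single-site operator `O` at `j`. -/
def siteOp {L : ℕ} (j : lattice L) (O : Op {(j : ℕ)}) : Op (lattice L) :=
  embed (Finset.singleton_subset_iff.2 j.2) O

/-- The Heisenberg evolution `U† A U`. -/
def heisenberg {S : Finset ℕ} (U A : Op S) : Op S := U.conjTranspose * A * U

/-- `ε_LR = C' ∫_{L'/2 - d_H}^∞ e^{-(x - vτ)/ξ} dx`. -/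
def epsLR (C' v ξ τ dH L' : ℝ) : ℝ :=
  C' * ∫ x in Set.Ioi (L' / 2 - dH), Real.exp (-(x - v * τ) / ξ)

theorem size_le {a b c : ℝ} (hb : 0 ≤ b) (h : a + 2 * b + 1 ≤ c) : a ≤ c := by linarith

end LocalCompilation

end

/-!
## Strategy

*Lieb-Robinson bound.* By Duhamel's principle (`norm_heisenbergEvolution_sub_le`) two Heisenberg
evolutions of `B` differ at most by the time integral of the commutator of the difference of the
Hamiltonians with the evolved `B`. For an operator `A` on a set `Z`, dropping all the terms that
touch `Z` gives a dynamics which commutes with `A`; so `[A, B(t)]` is controlled by the commutators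
of `B(s)` with the terms touching `Z`, which lie closer to `B` by at most `d_H`. Iterating, `A` at
distance at least `n (d_H + 1)` is reached at order `n` only, with an error `(2 K g t)^n / n!`, and
the exponential decay follows. The same principle, applied to the terms across the boundary
of a region, bounds the error of restricting the Hamiltonian
(`LocalTerms.norm_restriction_error_le`).

*Local costs.* Expanding the Bell projection in Pauli matrices `P`, the local cost at `j` is
`1 - 1/4 ∑_P 2^{-|S|} Tr[U† P_j U (V† P_j V)†]`. The identity contributes the same for all
unitaries, so that an error `ε` of the Heisenberg evolved Pauli operators changes the
cost by at most `3/4 ε` (`costLHSTAt_le_add`).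

*Light cones of the circuit.* In `Tr[A V† P_j V]` with `A` supported within distance `L'/2` of `j`,
a gate may be left out if it is not reached by the light cone of `P_j`, growing through the layers
from one end of the circuit, or if it is not reached by that of `A`, growing from the other end.
With `2 d = L'/2 + 2 d'` layers, the overlap of the two cones reaches at most
`L'/2 + d' + 1/2 ≤ L̃/2` away from `j` (`normTrace_mul_heisenberg_circuitIn`), hence the local cost
on the domain of size `L̃` is the one on the whole lattice (`costLHSTAt_ansatz_eq`).

*Global cost and fidelity.* The global cost is at most the sum of the local ones by the union bound
for the commuting projections onto the Bell pairs (`costHST_le_sum`). The average fidelity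
is an exact function of the global cost (`avgGateFidelity_eq`): splitting `U† V` into
its Hermitian and anti-Hermitian parts and diagonalizing these, only the fourth moments of a Haar
random state are needed, which follow from unitary invariance.
-/

namespace LocalCompilation

/-! ### Embeddings of local operators and supports -/

/-- Splitting of the basis states on `S` into their parts inside and outside of `X ⊆ S`. -/
def splitConfig {X S : Finset ℕ} (h : X ⊆ S) :
    Config S ≃ Config X × ({i : S // (i : ℕ) ∉ X} → Fin 2) where
  toFun s := (fun i => s ⟨i, h i.2⟩, fun i => s i)
  invFun p := fun i => if hi : (i : ℕ) ∈ X then p.1 ⟨i, hi⟩ else p.2 ⟨i, hi⟩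
  left_inv s := by
    funext i
    by_cases hi : (i : ℕ) ∈ X <;> simp [hi]
  right_inv p := by
    ext i
    · simp
    · simp [i.2]

theorem embed_eq_submatrix {X S : Finset ℕ} (h : X ⊆ S) (A : Op X) :
    embed h A = (A ⊗ₖ (1 : Matrix ({i : S // (i : ℕ) ∉ X} → Fin 2) _ ℂ)).submatrix
      (splitConfig h) (splitConfig h) := by
  ext s t
  have : (∀ i : S, (i : ℕ) ∉ X → s i = t i) ↔
      (splitConfig h s).2 = (splitConfig h t).2 := by
    simp [splitConfig, funext_iff]
  simp only [embed, Matrix.submatrix_apply, Matrix.kroneckerMap_apply, Matrix.one_apply, this,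
    mul_ite, mul_one, mul_zero]
  rfl

/-- The embedding `A ↦ A ⊗ I` as a homomorphism of star algebras. -/
def embedHom {X S : Finset ℕ} (h : X ⊆ S) : Op X →⋆ₐ[ℂ] Op S where
  toFun := embed h
  map_one' := by simp [embed_eq_submatrix]
  map_mul' A B := by
    simp [embed_eq_submatrix, Matrix.submatrix_mul_equiv, ← Matrix.mul_kronecker_mul]
  map_zero' := by simp [embed_eq_submatrix]
  map_add' A B := by
    simp only [embed_eq_submatrix, Matrix.add_kronecker]
    rfl
  commutes' r := by
    simp only [embed_eq_submatrix, Algebra.algebraMap_eq_smul_one, Matrix.smul_kronecker,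
      Matrix.one_kronecker_one, Matrix.submatrix_smul, Pi.smul_apply, Matrix.submatrix_one_equiv]
  map_star' A := by
    simp only [embed_eq_submatrix, Matrix.star_eq_conjTranspose, Matrix.conjTranspose_submatrix,
      Matrix.conjTranspose_kronecker, Matrix.conjTranspose_one]

theorem embedHom_apply {X S : Finset ℕ} (h : X ⊆ S) (A : Op X) : embedHom h A = embed h A := rfl

theorem embed_mul {X S : Finset ℕ} (h : X ⊆ S) (A B : Op X) :
    embed h (A * B) = embed h A * embed h B := map_mul (embedHom h) A B

theorem embed_one {X S : Finset ℕ} (h : X ⊆ S) : embed h 1 = 1 := map_one (embedHom h)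

theorem embed_conjTranspose {X S : Finset ℕ} (h : X ⊆ S) (A : Op X) :
    embed h A.conjTranspose = (embed h A).conjTranspose := map_star (embedHom h) A

theorem norm_embed_le {X S : Finset ℕ} (h : X ⊆ S) (A : Op X) : ‖embed h A‖ ≤ ‖A‖ :=
  NonUnitalStarAlgHom.norm_apply_le (embedHom h) A

theorem embed_embed {X Y S : Finset ℕ} (h : X ⊆ Y) (h' : Y ⊆ S) (A : Op X) :
    embed h' (embed h A) = embed (h.trans h') A := by
  ext s t
  unfold embed
  by_cases h1 : ∀ i : S, (i : ℕ) ∉ X → s i = t i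
  · rw [if_pos fun i hi => h1 i fun hX => hi (h hX), if_pos h1]
    have h3 : ∀ i : Y, (i : ℕ) ∉ X → s ⟨i, h' i.2⟩ = t ⟨i, h' i.2⟩ := fun i hi => h1 _ hi
    exact if_pos h3
  · rw [if_neg h1]
    split_ifs with h2 h3
    · refine absurd (fun i hi => ?_) h1
      by_cases hY : (i : ℕ) ∈ Y
      · exact h3 ⟨i, hY⟩ hi
      · exact h2 i hY
    · rfl
    · rfl

theorem embed_self {S : Finset ℕ} (h : S ⊆ S) (A : Op S) : embed h A = A := by
  ext s t
  exact if_pos fun i hi => absurd i.2 hi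

/-- The product of embedded operators with disjoint supports, entry by entry: only the
intermediate state agreeing with `t` on `X` and with `s` elsewhere contributes. -/
theorem embed_mul_embed_apply {X Y S : Finset ℕ} (hX : X ⊆ S) (hY : Y ⊆ S) (hXY : Disjoint X Y)
    (A : Op X) (B : Op Y) (s t : Config S) :
    (embed hX A * embed hY B) s t =
      if ∀ i : S, (i : ℕ) ∉ X → (i : ℕ) ∉ Y → s i = t i then
        A (fun i => s ⟨i, hX i.2⟩) (fun i => t ⟨i, hX i.2⟩) *
          B (fun i => s ⟨i, hY i.2⟩) (fun i => t ⟨i, hY i.2⟩) else 0 := by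
  have hd : ∀ {a : ℕ}, a ∈ Y → a ∉ X := fun ha hb => Finset.disjoint_left.1 hXY hb ha
  rw [Matrix.mul_apply, Finset.sum_eq_single (fun i : S => if (i : ℕ) ∈ X then t i else s i)]
  · unfold embed
    rw [if_pos (by intro i hi; simp [hi])]
    have e1 : (fun i : X => (fun i : S => if (i : ℕ) ∈ X then t i else s i) ⟨i, hX i.2⟩) =
        fun i : X => t ⟨i, hX i.2⟩ := by funext i; simp
    have e2 : (fun i : Y => (fun i : S => if (i : ℕ) ∈ X then t i else s i) ⟨i, hY i.2⟩) =
        fun i : Y => s ⟨i, hY i.2⟩ := by funext i; simp [hd i.2]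
    rw [e1, e2]
    have : (∀ i : S, (i : ℕ) ∉ Y → (if (i : ℕ) ∈ X then t i else s i) = t i) ↔
        ∀ i : S, (i : ℕ) ∉ X → (i : ℕ) ∉ Y → s i = t i := by
      refine forall_congr' fun i => ?_
      by_cases hi : (i : ℕ) ∈ X <;> simp [hi]
    simp only [this, mul_ite, mul_zero]
  · intro r _ hr
    unfold embed
    split_ifs with h1 h2 <;> try simp
    refine absurd (funext fun i => ?_) hr
    by_cases hi : (i : ℕ) ∈ X
    · simp [hi, h2 i (fun h => hd h hi)]
    · simp [hi, h1 i hi]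
  · simp

theorem embed_commute {X Y S : Finset ℕ} (hX : X ⊆ S) (hY : Y ⊆ S) (hXY : Disjoint X Y)
    (A : Op X) (B : Op Y) : Commute (embed hX A) (embed hY B) := by
  ext s t
  rw [embed_mul_embed_apply hX hY hXY, embed_mul_embed_apply hY hX hXY.symm]
  have : (∀ i : S, (i : ℕ) ∉ X → (i : ℕ) ∉ Y → s i = t i) ↔
      ∀ i : S, (i : ℕ) ∉ Y → (i : ℕ) ∉ X → s i = t i :=
    forall_congr' fun i => ⟨fun h a b => h b a, fun h a b => h b a⟩
  simp only [this, mul_comm]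

/-- `A` acts on the sites of `X` only: it is of the form `A₀ ⊗ I_{S \ X}`. -/
def SupportedOn {S : Finset ℕ} (X : Finset ℕ) (A : Op S) : Prop :=
  ∃ (h : X ⊆ S) (A₀ : Op X), A = embed h A₀

theorem SupportedOn.subset {S X : Finset ℕ} {A : Op S} (hA : SupportedOn X A) : X ⊆ S := hA.1

theorem supportedOn_embed {X S : Finset ℕ} (h : X ⊆ S) (A : Op X) : SupportedOn X (embed h A) :=
  ⟨h, A, rfl⟩

theorem SupportedOn.mono {S X Y : Finset ℕ} {A : Op S} (hA : SupportedOn X A) (hXY : X ⊆ Y)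
    (hY : Y ⊆ S) : SupportedOn Y A := by
  obtain ⟨h, A, rfl⟩ := hA
  exact ⟨hY, embed hXY A, (embed_embed _ _ _).symm⟩

theorem SupportedOn.mul {S X : Finset ℕ} {A B : Op S} (hA : SupportedOn X A)
    (hB : SupportedOn X B) : SupportedOn X (A * B) := by
  obtain ⟨h, A, rfl⟩ := hA
  obtain ⟨_, B, rfl⟩ := hB
  exact ⟨h, A * B, (embed_mul _ _ _).symm⟩

theorem SupportedOn.conjTranspose {S X : Finset ℕ} {A : Op S} (hA : SupportedOn X A) :
    SupportedOn X A.conjTranspose := by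
  obtain ⟨h, A, rfl⟩ := hA
  exact ⟨h, A.conjTranspose, (embed_conjTranspose _ _).symm⟩

theorem SupportedOn.commute {S X Y : Finset ℕ} {A B : Op S} (hA : SupportedOn X A)
    (hB : SupportedOn Y B) (hXY : Disjoint X Y) : Commute A B := by
  obtain ⟨h, A, rfl⟩ := hA
  obtain ⟨h', B, rfl⟩ := hB
  exact embed_commute h h' hXY A B

/-! ### The normalized trace -/

/-- The normalized trace `2^{-|S|} Tr A`. -/
noncomputable def normTrace {S : Finset ℕ} (A : Op S) : ℂ := (2 ^ S.card : ℂ)⁻¹ * A.trace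

theorem card_config (S : Finset ℕ) : Fintype.card (Config S) = 2 ^ S.card := by simp

theorem normTrace_embed {X S : Finset ℕ} (h : X ⊆ S) (A : Op X) :
    normTrace (embed h A) = normTrace A := by
  have hc : (Fintype.card ({i : S // (i : ℕ) ∉ X} → Fin 2)) * 2 ^ X.card = 2 ^ S.card := by
    have := Fintype.card_congr (splitConfig h)
    rw [Fintype.card_prod, card_config, card_config] at this
    rw [this, mul_comm]
  have hc' : ((Fintype.card ({i : S // (i : ℕ) ∉ X} → Fin 2) : ℕ) : ℂ) * 2 ^ X.card =
      2 ^ S.card := by exact_mod_cast hc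
  have ht : (embed h A).trace =
      A.trace * (Fintype.card ({i : S // (i : ℕ) ∉ X} → Fin 2) : ℂ) := by
    rw [embed_eq_submatrix, ← Matrix.trace_one, ← Matrix.trace_kronecker]
    exact Equiv.sum_comp (splitConfig h) fun i => (A ⊗ₖ (1 : Matrix _ _ ℂ)) i i
  have h2 : (2 : ℂ) ^ X.card ≠ 0 := pow_ne_zero _ two_ne_zero
  have h3 : (2 : ℂ) ^ S.card ≠ 0 := pow_ne_zero _ two_ne_zero
  unfold normTrace
  rw [ht, ← hc']
  rw [← hc'] at h3
  field_simp [left_ne_zero_of_mul h3]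

theorem norm_entry_le {n : Type*} [Fintype n] [DecidableEq n] (A : Matrix n n ℂ) (i j : n) :
    ‖A i j‖ ≤ ‖A‖ := by
  have h := A.l2_opNorm_mulVec (EuclideanSpace.single j (1 : ℂ))
  have h2 := PiLp.norm_apply_le ((EuclideanSpace.equiv n ℂ).symm
    (A.mulVec (EuclideanSpace.single j (1 : ℂ)))) i
  simpa using h2.trans h

theorem norm_normTrace_le {S : Finset ℕ} (A : Op S) : ‖normTrace A‖ ≤ ‖A‖ := by
  have h1 : ‖A.trace‖ ≤ 2 ^ S.card * ‖A‖ := by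
    calc ‖A.trace‖ ≤ ∑ s : Config S, ‖A s s‖ := norm_sum_le _ _
      _ ≤ ∑ _s : Config S, ‖A‖ := Finset.sum_le_sum fun s _ => norm_entry_le A s s
      _ = _ := by rw [Finset.sum_const, Finset.card_univ, card_config]; simp
  unfold normTrace
  rw [norm_mul, norm_inv, norm_pow, Complex.norm_ofNat]
  rw [inv_mul_le_iff₀ (by positivity)]
  exact h1

theorem normTrace_mul_comm {S : Finset ℕ} (A B : Op S) :
    normTrace (A * B) = normTrace (B * A) := by
  rw [normTrace, normTrace, Matrix.trace_mul_comm]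

/-! ### Heisenberg dynamics in a C*-algebra -/

section Dynamics

variable {𝔸 : Type*} [CStarAlgebra 𝔸]

/-- The propagator `exp(-i t H)`. -/
noncomputable def propagator (H : 𝔸) (t : ℝ) : 𝔸 :=
  NormedSpace.exp ((-(Complex.I * (t : ℂ))) • H)

/-- The Heisenberg evolution `exp(i t H) B exp(-i t H)`. -/
noncomputable def heisenbergEvolution (H : 𝔸) (t : ℝ) (B : 𝔸) : 𝔸 :=
  star (propagator H t) * B * propagator H t

theorem star_propagator {H : 𝔸} (hH : IsSelfAdjoint H) (t : ℝ) :
    star (propagator H t) = propagator H (-t) := by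
  unfold propagator
  rw [NormedSpace.star_exp, star_smul, hH.star_eq]
  congr 2
  simp

theorem propagator_mem_unitary {H : 𝔸} (hH : IsSelfAdjoint H) (t : ℝ) :
    propagator H t ∈ unitary 𝔸 := by
  have h : ∀ s : ℝ, propagator H (-s) * propagator H s = 1 := fun s => by
    unfold propagator
    let _ : NormedAlgebra ℚ 𝔸 := NormedAlgebra.restrictScalars ℚ ℂ 𝔸
    rw [← NormedSpace.exp_add_of_commute ((Commute.refl H).smul_left _ |>.smul_right _),
      ← add_smul]
    simp
  rw [Unitary.mem_iff, star_propagator hH]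
  exact ⟨h t, by simpa using h (-t)⟩

theorem hasDerivAt_propagator (H : 𝔸) (t : ℝ) :
    HasDerivAt (propagator H) (propagator H t * (-Complex.I • H)) t := by
  have h := hasDerivAt_exp_smul_const (𝕂 := ℝ) (-Complex.I • H) t
  have e : (fun u : ℝ => NormedSpace.exp (u • (-Complex.I • H))) = propagator H := by
    funext u
    unfold propagator
    rw [← Complex.coe_smul, smul_smul]
    congr 2
    ring
  rw [e, congrFun e t] at h
  exact h

theorem commute_propagator {A H : 𝔸} (h : Commute A H) (t : ℝ) : Commute A (propagator H t) :=
  (h.smul_right _).exp_right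

theorem propagator_mul_commute (H : 𝔸) (t : ℝ) : Commute H (propagator H t) :=
  commute_propagator (Commute.refl H) t

theorem norm_heisenbergEvolution {H : 𝔸} (hH : IsSelfAdjoint H) (t : ℝ) (B : 𝔸) :
    ‖heisenbergEvolution H t B‖ = ‖B‖ := by
  have hU := propagator_mem_unitary hH t
  unfold heisenbergEvolution
  rw [CStarRing.norm_mul_mem_unitary _ hU, CStarRing.norm_mem_unitary_mul _ (Unitary.star_mem hU)]

theorem commute_heisenbergEvolution {A B H : 𝔸} (hH : IsSelfAdjoint H) (hAH : Commute A H)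
    (hAB : Commute A B) (t : ℝ) : Commute A (heisenbergEvolution H t B) := by
  unfold heisenbergEvolution
  rw [star_propagator hH]
  exact ((commute_propagator hAH _).mul_right hAB).mul_right (commute_propagator hAH _)

theorem norm_lie_le (A B : 𝔸) : ‖⁅A, B⁆‖ ≤ 2 * ‖A‖ * ‖B‖ := by
  rw [Ring.lie_def]
  calc ‖A * B - B * A‖ ≤ ‖A * B‖ + ‖B * A‖ := norm_sub_le _ _
    _ ≤ ‖A‖ * ‖B‖ + ‖B‖ * ‖A‖ := add_le_add (norm_mul_le _ _) (norm_mul_le _ _)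
    _ = _ := by ring

/-- Duhamel's principle: Heisenberg evolutions under `H` and `K` differ at most by the integral
of `‖[H - K, e^{isH} B e^{-isH}]‖`. Here `b` is a primitive of a bound on the integrand. -/
theorem norm_heisenbergEvolution_sub_le {H K B : 𝔸} (hH : IsSelfAdjoint H) (hK : IsSelfAdjoint K)
    {t : ℝ} (ht : 0 ≤ t) {b b' : ℝ → ℝ} (hb0 : 0 ≤ b 0) (hb : ∀ s, HasDerivAt b (b' s) s)
    (bound : ∀ s, 0 ≤ s → s ≤ t → ‖⁅H - K, heisenbergEvolution H s B⁆‖ ≤ b' s) :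
    ‖heisenbergEvolution H t B - heisenbergEvolution K t B‖ ≤ b t := by
  have hU := propagator_mem_unitary hH
  have hV := propagator_mem_unitary hK
  -- In the frame rotating with `K` the derivative is the conjugated commutator with `H - K`.
  set f : ℝ → 𝔸 := fun s =>
    propagator K s * heisenbergEvolution H s B * star (propagator K s) - B with hf
  have hder : ∀ s, HasDerivAt f (propagator K s *
      (Complex.I • ⁅H - K, heisenbergEvolution H s B⁆) * star (propagator K s)) s := by
    intro s
    have dU := hasDerivAt_propagator H s
    have dV := hasDerivAt_propagator K s
    have dU' : HasDerivAt (fun s => star (propagator H s)) _ s := dU.star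
    have dV' : HasDerivAt (fun s => star (propagator K s)) _ s := dV.star
    have := ((dV.mul ((dU'.mul_const B).mul dU)).mul dV').sub_const B
    refine this.congr_deriv ?_
    simp only [Pi.mul_apply, star_mul, star_smul, hH.star_eq, hK.star_eq,
      heisenbergEvolution, Ring.lie_def, Complex.star_def, map_neg, Complex.conj_I, neg_neg]
    have c1 : propagator H s * H = H * propagator H s := (propagator_mul_commute H s).eq.symm
    simp only [mul_add, add_mul, mul_sub, sub_mul, smul_sub, smul_mul_assoc, mul_smul_comm,
      neg_smul, neg_mul, mul_neg, ← mul_assoc]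
    have c2 : star (propagator H s) * H = H * star (propagator H s) := by
      rw [star_propagator hH]; exact (propagator_mul_commute H _).eq.symm
    have c3 : ∀ x, x * propagator H s * H = x * H * propagator H s := fun x => by
      rw [mul_assoc, c1, ← mul_assoc]
    simp only [c3]
    abel
  have h0 : f 0 = 0 := by simp [hf, heisenbergEvolution, propagator]
  have key := image_norm_le_of_norm_deriv_right_le_deriv_boundary (f := f) (a := 0) (b := t)
    (fun s _ => (hder s).continuousAt.continuousWithinAt)
    (fun s _ => (hder s).hasDerivWithinAt) (B := b) (B' := b') (by rwa [h0, norm_zero]) hb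
    (fun s hs => by
      rw [CStarRing.norm_mul_mem_unitary _ (Unitary.star_mem (hV s)),
        CStarRing.norm_mem_unitary_mul _ (hV s), norm_smul, Complex.norm_I, one_mul]
      exact bound s hs.1 hs.2.le) (Set.right_mem_Icc.2 ht)
  have hfin : f t = propagator K t *
      (heisenbergEvolution H t B - heisenbergEvolution K t B) * star (propagator K t) := by
    have e : propagator K t * heisenbergEvolution K t B * star (propagator K t) = B := by
      unfold heisenbergEvolution
      calc _ = (propagator K t * star (propagator K t)) * B *
            (propagator K t * star (propagator K t)) := by simp only [mul_assoc]
        _ = B := by rw [Unitary.mul_star_self_of_mem (hV t)]; simp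
    rw [mul_sub, sub_mul, e]
  rwa [hfin, CStarRing.norm_mul_mem_unitary _ (Unitary.star_mem (hV t)),
    CStarRing.norm_mem_unitary_mul _ (hV t)] at key

end Dynamics

/-! ### Lieb-Robinson bound -/

/-- A finite family of self-adjoint terms `T X`, `X ∈ F`, on the sites `S`, each acting on at most
`K` sites within distance `dH` of each other, with local energy scale `g`. -/
structure LocalTerms {S : Finset ℕ} (F : Finset (Finset ℕ)) (T : Finset ℕ → Op S)
    (g : ℝ) (K : ℕ) (dH : ℝ) : Prop where
  selfAdjoint : ∀ X ∈ F, IsSelfAdjoint (T X)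
  supported : ∀ X ∈ F, SupportedOn X (T X)
  extensive : ∀ x ∈ S, ∑ X ∈ F with x ∈ X, ‖T X‖ ≤ g
  card_le : ∀ X ∈ F, X.card ≤ K
  dist_le : ∀ X ∈ F, ∀ x ∈ X, ∀ y ∈ X, siteDist x y ≤ dH

section LiebRobinson

variable {S : Finset ℕ} {F : Finset (Finset ℕ)} {T : Finset ℕ → Op S} {g dH : ℝ} {K : ℕ}

theorem LocalTerms.subfamily {F' : Finset (Finset ℕ)} (hT : LocalTerms F T g K dH)
    (hF : F' ⊆ F) : LocalTerms F' T g K dH where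
  selfAdjoint X hX := hT.selfAdjoint X (hF hX)
  supported X hX := hT.supported X (hF hX)
  extensive x hx := (Finset.sum_le_sum_of_subset_of_nonneg (Finset.filter_subset_filter _ hF)
    fun _ _ _ => norm_nonneg _).trans (hT.extensive x hx)
  card_le X hX := hT.card_le X (hF hX)
  dist_le X hX := hT.dist_le X (hF hX)

theorem LocalTerms.isSelfAdjoint_sum (hT : LocalTerms F T g K dH) :
    IsSelfAdjoint (∑ X ∈ F, T X) := by
  rw [IsSelfAdjoint, star_sum]
  exact Finset.sum_congr rfl fun X hX => hT.selfAdjoint X hX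

/-- The terms touching a set `Z` have total norm at most `g` times the number of sites of `Z`. -/
theorem LocalTerms.sum_norm_touching_le (hT : LocalTerms F T g K dH) {Z : Finset ℕ} (hZ : Z ⊆ S)
    {G : Finset (Finset ℕ)} (hG : ∀ X ∈ G, X ∈ F ∧ ∃ x ∈ Z, x ∈ X) :
    ∑ X ∈ G, ‖T X‖ ≤ Z.card * g := by
  calc ∑ X ∈ G, ‖T X‖ ≤ ∑ X ∈ G, ∑ x ∈ Z, if x ∈ X then ‖T X‖ else 0 := by
        refine Finset.sum_le_sum fun X hX => ?_
        obtain ⟨x, hx, hxX⟩ := (hG X hX).2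
        have := Finset.single_le_sum (f := fun x => if x ∈ X then ‖T X‖ else 0)
          (fun y _ => by split_ifs <;> simp) hx
        simpa [hxX] using this
    _ ≤ ∑ X ∈ F, ∑ x ∈ Z, if x ∈ X then ‖T X‖ else 0 :=
        Finset.sum_le_sum_of_subset_of_nonneg (fun X hX => (hG X hX).1) fun _ _ _ =>
          Finset.sum_nonneg fun _ _ => by split_ifs <;> simp
    _ = ∑ x ∈ Z, ∑ X ∈ F with x ∈ X, ‖T X‖ := by
        rw [Finset.sum_comm]
        exact Finset.sum_congr rfl fun x _ => (Finset.sum_filter _ _).symm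
    _ ≤ ∑ _x ∈ Z, g := Finset.sum_le_sum fun x hx => hT.extensive x (hZ hx)
    _ = _ := by rw [Finset.sum_const, nsmul_eq_mul]

theorem siteDist_comm (i j : ℕ) : siteDist i j = siteDist j i := abs_sub_comm _ _

theorem siteDist_triangle (i j l : ℕ) : siteDist i l ≤ siteDist i j + siteDist j l :=
  abs_sub_le _ _ _

theorem siteDist_self (i : ℕ) : siteDist i i = 0 := by simp [siteDist]

/-- Lieb-Robinson bound in the form given by iterating Duhamel's principle: an operator at distance
at least `n (d_H + 1)` from `j` is reached at the `n`-th order only. In each step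
the comparison dynamics leaves out the terms touching the support `Z`, so that the operator on `Z`
commutes with it. -/
theorem LocalTerms.norm_lie_heisenbergEvolution_le (hT : LocalTerms F T g K dH) (hg : 0 ≤ g)
    (hd : 0 ≤ dH) {j : ℕ} {B : Op S} (hB : SupportedOn {j} B) (n : ℕ) :
    ∀ {Z : Finset ℕ} {A : Op S}, SupportedOn Z A → Z.card ≤ K →
      (∀ x ∈ Z, n * (dH + 1) ≤ siteDist x j) → ∀ t : ℝ, 0 ≤ t →
      ‖⁅A, heisenbergEvolution (∑ X ∈ F, T X) t B⁆‖ ≤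
        2 * ‖A‖ * (‖B‖ * ((2 * K * g * t) ^ n / n.factorial)) := by
  have hH := hT.isSelfAdjoint_sum
  induction n with
  | zero =>
    intro Z A _ _ _ t _
    refine (norm_lie_le _ _).trans ?_
    rw [norm_heisenbergEvolution hH]
    simp
  | succ n ih =>
    intro Z A hA hZ hdist t ht
    set G := F.filter fun X => Disjoint X Z with hG
    have hTG : LocalTerms G T g K dH := hT.subfamily (Finset.filter_subset _ _)
    have hHG := hTG.isSelfAdjoint_sum
    have hsplit : (∑ X ∈ F, T X) - ∑ X ∈ G, T X = ∑ X ∈ F with ¬ Disjoint X Z, T X := by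
      rw [sub_eq_iff_eq_add, add_comm]
      exact (Finset.sum_filter_add_sum_filter_not F _ _).symm
    have hjZ : Disjoint Z {j} := by
      rw [Finset.disjoint_singleton_right]
      intro hj
      have := hdist j hj
      rw [siteDist_self] at this
      have : (0 : ℝ) < ((n + 1 : ℕ) : ℝ) * (dH + 1) := by positivity
      linarith
    have hcomm : Commute A (heisenbergEvolution (∑ X ∈ G, T X) t B) := by
      refine commute_heisenbergEvolution hHG ?_ (hA.commute hB hjZ) t
      refine Commute.sum_right _ _ _ fun X hX => ?_
      exact hA.commute (hTG.supported X hX) (Finset.mem_filter.1 hX).2.symm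
    have e : ⁅A, heisenbergEvolution (∑ X ∈ F, T X) t B⁆ =
        ⁅A, heisenbergEvolution (∑ X ∈ F, T X) t B -
          heisenbergEvolution (∑ X ∈ G, T X) t B⁆ := by
      rw [Ring.lie_def, Ring.lie_def, mul_sub, sub_mul, hcomm.eq]
      abel
    rw [e]
    refine (norm_lie_le _ _).trans (mul_le_mul_of_nonneg_left ?_ (by positivity))
    refine norm_heisenbergEvolution_sub_le hH hHG ht
      (b := fun s => ‖B‖ * ((2 * K * g * s) ^ (n + 1) / (n + 1).factorial))
      (b' := fun s => 2 * K * g * (‖B‖ * ((2 * K * g * s) ^ n / n.factorial))) (by simp) ?_ ?_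
    · intro s
      have h1 : HasDerivAt (fun s : ℝ => 2 * K * g * s) (2 * K * g) s := by
        simpa using (hasDerivAt_id s).const_mul (2 * K * g)
      refine (((h1.pow (n + 1)).div_const _).const_mul ‖B‖).congr_deriv ?_
      rw [Nat.factorial_succ]
      push_cast
      field_simp
    · intro s hs _
      rw [hsplit, LieRing.of_associative_ring_bracket, Finset.sum_mul, Finset.mul_sum,
        ← Finset.sum_sub_distrib]
      have hZK : (Z.card : ℝ) * g ≤ K * g := by gcongr
      have hsum := hT.sum_norm_touching_le hA.subset
        (G := F.filter fun X => ¬ Disjoint X Z) (fun X hX => by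
          obtain ⟨h1, h2⟩ := Finset.mem_filter.1 hX
          obtain ⟨x, hx, hx'⟩ := Finset.not_disjoint_iff.1 h2
          exact ⟨h1, x, hx', hx⟩)
      calc _ ≤ ∑ X ∈ F with ¬ Disjoint X Z,
            2 * ‖T X‖ * (‖B‖ * ((2 * K * g * s) ^ n / n.factorial)) := by
            refine norm_sum_le_of_le _ fun X hX => ?_
            obtain ⟨h1, h2⟩ := Finset.mem_filter.1 hX
            obtain ⟨x, hx, hx'⟩ := Finset.not_disjoint_iff.1 h2
            refine ih (hT.supported X h1) (hT.card_le X h1) (fun y hy => ?_) s hs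
            have h3 := hdist x hx'
            have h4 := siteDist_triangle x y j
            have h5 := hT.dist_le X h1 x hx y hy
            push_cast at h3
            linarith
        _ = 2 * (∑ X ∈ F with ¬ Disjoint X Z, ‖T X‖) *
              (‖B‖ * ((2 * K * g * s) ^ n / n.factorial)) := by
            rw [← Finset.sum_mul, ← Finset.mul_sum]
        _ ≤ _ := by
            refine mul_le_mul_of_nonneg_right ?_ (by positivity)
            linarith

/-- Trades the factorial for exponential decay in the order `n`: `(e y)^n / n! ≤ e^{e y}`. -/
theorem pow_div_factorial_le {y : ℝ} (hy : 0 ≤ y) (n : ℕ) :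
    y ^ n / n.factorial ≤ Real.exp (-n) * Real.exp (Real.exp 1 * y) := by
  have h := Real.pow_div_factorial_le_exp (Real.exp 1 * y) (by positivity) n
  rw [mul_pow, ← Real.exp_nat_mul, mul_one, mul_div_assoc] at h
  rw [Real.exp_neg, ← div_eq_inv_mul, le_div_iff₀ (Real.exp_pos _)]
  linarith

/-- Lieb-Robinson bound with exponential decay, at distance `r` from `j`. -/
theorem LocalTerms.norm_lie_heisenbergEvolution_le_exp (hT : LocalTerms F T g K dH) (hg : 0 ≤ g)
    (hd : 0 ≤ dH) {j : ℕ} {B : Op S} (hB : SupportedOn {j} B) {Z : Finset ℕ} {A : Op S}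
    (hA : SupportedOn Z A) (hZ : Z.card ≤ K) {r : ℝ} (hr : 0 ≤ r)
    (hdist : ∀ x ∈ Z, r ≤ siteDist x j) {t : ℝ} (ht : 0 ≤ t) :
    ‖⁅A, heisenbergEvolution (∑ X ∈ F, T X) t B⁆‖ ≤
      2 * ‖A‖ * (‖B‖ * (Real.exp 1 * Real.exp (-r / (dH + 1)) *
        Real.exp (Real.exp 1 * (2 * K * g * t)))) := by
  -- the number of steps of length `d_H + 1` that fit into the distance `r`
  set n := ⌊r / (dH + 1)⌋₊ with hn
  have hD : 0 < dH + 1 := by linarith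
  have h1 : (n : ℝ) * (dH + 1) ≤ r :=
    (le_div_iff₀ hD).1 (Nat.floor_le (div_nonneg hr hD.le))
  have h2 : r / (dH + 1) < n + 1 := Nat.lt_floor_add_one _
  refine (hT.norm_lie_heisenbergEvolution_le hg hd hB n hA hZ
    (fun x hx => h1.trans (hdist x hx)) t ht).trans ?_
  gcongr
  refine (pow_div_factorial_le (by positivity) n).trans ?_
  rw [← Real.exp_add 1]
  gcongr
  rw [neg_div]
  linarith

theorem card_le_of_mem_interval {s : Finset ℕ} {a w : ℝ} (hw : 0 ≤ w)
    (hs : ∀ x ∈ s, a ≤ x ∧ (x : ℝ) ≤ a + w) : (s.card : ℝ) ≤ w + 1 := by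
  rcases s.eq_empty_or_nonempty with rfl | hne
  · simp; linarith
  · have hsub : s ⊆ Finset.Icc (s.min' hne) (s.max' hne) := fun x hx =>
      Finset.mem_Icc.2 ⟨s.min'_le x hx, s.le_max' x hx⟩
    have h1 := Finset.card_le_card hsub
    rw [Nat.card_Icc] at h1
    have h2 := hs _ (s.min'_mem hne)
    have h3 := hs _ (s.max'_mem hne)
    have h4 : s.card + s.min' hne ≤ s.max' hne + 1 := by
      have := s.min'_le_max' hne
      omega
    have h5 : (s.card : ℝ) + (s.min' hne : ℕ) ≤ (s.max' hne : ℕ) + 1 := by exact_mod_cast h4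
    linarith

theorem card_shell_le {s : Finset ℕ} {j : ℕ} {r w : ℝ} (hw : 0 ≤ w)
    (hs : ∀ x ∈ s, r ≤ siteDist x j ∧ siteDist x j ≤ r + w) : (s.card : ℝ) ≤ 2 * (w + 1) := by
  have h1 := card_le_of_mem_interval (s := s.filter fun x => j ≤ x) (a := j + r) hw (by
    intro x hx
    obtain ⟨h1, h2⟩ := Finset.mem_filter.1 hx
    have h3 : (j : ℝ) ≤ x := by exact_mod_cast h2
    have h4 := hs x h1
    rw [siteDist, abs_of_nonneg (by linarith)] at h4
    constructor <;> linarith)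
  have h2 := card_le_of_mem_interval (s := s.filter fun x => ¬ j ≤ x) (a := j - r - w) hw (by
    intro x hx
    obtain ⟨h1, h2⟩ := Finset.mem_filter.1 hx
    have h3 : (x : ℝ) ≤ j := by exact_mod_cast (not_le.1 h2).le
    have h4 := hs x h1
    rw [siteDist, abs_of_nonpos (by linarith)] at h4
    constructor <;> linarith)
  have h3 := Finset.card_filter_add_card_filter_not (s := s) fun x => j ≤ x
  have h4 : ((s.filter fun x => j ≤ x).card : ℝ) + (s.filter fun x => ¬ j ≤ x).card = s.card := by
    exact_mod_cast h3
  linarith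

/-- Restricting the Hamiltonian to the terms inside a region `D ∋ j`, where `D` contains all the
sites within distance `r + d_H` of `j`, changes the evolution of an operator at `j` by an
exponentially small amount: only terms across the boundary of `D` contribute
to Duhamel's formula. -/
theorem LocalTerms.norm_restriction_error_le (hT : LocalTerms F T g K dH) (hg : 0 ≤ g)
    (hd : 0 ≤ dH) {j : ℕ} {B : Op S} (hB : SupportedOn {j} B) {D : Finset ℕ} {r : ℝ} (hr : 0 ≤ r)
    (hD : ∀ x, x ∈ D ↔ x ∈ S ∧ siteDist x j ≤ r + dH) {t : ℝ} (ht : 0 ≤ t) :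
    ‖heisenbergEvolution (∑ X ∈ F, T X) t B -
        heisenbergEvolution (∑ X ∈ F with X ⊆ D, T X) t B‖ ≤
      2 * (2 * (dH + 1) * g) * (‖B‖ * (Real.exp 1 * Real.exp (-r / (dH + 1)) *
        Real.exp (Real.exp 1 * (2 * K * g * t)))) * t := by
  have hTD : LocalTerms (F.filter fun X => X ⊆ D) T g K dH :=
    hT.subfamily (Finset.filter_subset _ _)
  have hj : j ∈ D := (hD j).2 ⟨hB.subset (Finset.mem_singleton_self j), by
    rw [siteDist_self]; linarith⟩
  set c := 2 * (2 * (dH + 1) * g) * (‖B‖ * (Real.exp 1 * Real.exp (-r / (dH + 1)) *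
        Real.exp (Real.exp 1 * (2 * K * g * t)))) with hc
  rw [norm_sub_rev]
  refine norm_heisenbergEvolution_sub_le hTD.isSelfAdjoint_sum hT.isSelfAdjoint_sum ht
    (b := fun s => c * s) (b' := fun _ => c) (by simp)
    (fun s => by simpa using (hasDerivAt_id s).const_mul c) fun s hs hst => ?_
  have hsplit : (∑ X ∈ F with X ⊆ D, T X) - ∑ X ∈ F, T X = - ∑ X ∈ F with ¬ X ⊆ D, T X := by
    rw [← Finset.sum_filter_add_sum_filter_not F (fun X => X ⊆ D) T]
    abel
  rw [hsplit, Ring.lie_def, neg_mul, mul_neg, ← neg_sub', norm_neg, Finset.sum_mul,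
    Finset.mul_sum, ← Finset.sum_sub_distrib]
  set G := (F.filter fun X => ¬ X ⊆ D).filter fun X => ¬ Disjoint X D with hG
  -- Terms outside of `D` commute with the restricted evolution.
  have hzero : ∀ X ∈ F.filter fun X => ¬ X ⊆ D, X ∉ G →
      T X * heisenbergEvolution (∑ X ∈ F with X ⊆ D, T X) s B -
        heisenbergEvolution (∑ X ∈ F with X ⊆ D, T X) s B * T X = 0 := by
    intro X hX hXG
    have hdis : Disjoint X D := by
      by_contra h
      exact hXG (Finset.mem_filter.2 ⟨hX, h⟩)
    have hXS := hT.supported X (Finset.mem_filter.1 hX).1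
    refine sub_eq_zero.2 (commute_heisenbergEvolution hTD.isSelfAdjoint_sum ?_ ?_ s).eq
    · refine Commute.sum_right _ _ _ fun Y hY => ?_
      obtain ⟨h1, h2⟩ := Finset.mem_filter.1 hY
      exact hXS.commute (hT.supported Y h1) (Finset.disjoint_of_subset_right h2 hdis)
    · refine hXS.commute hB ?_
      rw [Finset.disjoint_singleton_right]
      exact fun h => Finset.disjoint_left.1 hdis h hj
  rw [← Finset.sum_subset (Finset.filter_subset _ _) hzero]
  have hfar : ∀ X ∈ G, ∀ x ∈ X, r ≤ siteDist x j := by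
    intro X hX x hx
    obtain ⟨h1, h2⟩ := Finset.mem_filter.1 (Finset.mem_filter.1 hX).1
    obtain ⟨y, hy, hyD⟩ := Finset.not_subset.1 h2
    rw [hD] at hyD
    have h3 : r + dH < siteDist y j := by
      by_contra h
      exact hyD ⟨(hT.supported X h1).subset hy, not_lt.1 h⟩
    have h4 := siteDist_triangle y x j
    have h5 := hT.dist_le X h1 y hy x hx
    linarith
  -- Every term across the boundary touches the shell `Z` of width `d_H` inside of `D`.
  set Z := D.filter fun x => r ≤ siteDist x j with hZ
  have hZcard : (Z.card : ℝ) ≤ 2 * (dH + 1) := card_shell_le hd fun x hx => by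
    obtain ⟨h1, h2⟩ := Finset.mem_filter.1 hx
    exact ⟨h2, ((hD x).1 h1).2⟩
  have hsum := hT.sum_norm_touching_le (Z := Z)
    (fun x hx => ((hD x).1 (Finset.mem_filter.1 hx).1).1) (G := G) fun X hX => by
      obtain ⟨h1, h2⟩ := Finset.mem_filter.1 hX
      obtain ⟨x, hx, hxD⟩ := Finset.not_disjoint_iff.1 h2
      exact ⟨(Finset.mem_filter.1 h1).1, x, Finset.mem_filter.2 ⟨hxD, hfar X hX x hx⟩, hx⟩
  set q := ‖B‖ * (Real.exp 1 * Real.exp (-r / (dH + 1)) *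
        Real.exp (Real.exp 1 * (2 * K * g * t))) with hq
  calc _ ≤ ∑ X ∈ G, 2 * ‖T X‖ * q := by
        refine norm_sum_le_of_le _ fun X hX => ?_
        have hXF := (Finset.mem_filter.1 (Finset.mem_filter.1 hX).1).1
        refine (hTD.norm_lie_heisenbergEvolution_le_exp hg hd hB (hT.supported X hXF)
          (hT.card_le X hXF) hr (hfar X hX) hs).trans ?_
        rw [hq]
        gcongr
    _ = 2 * (∑ X ∈ G, ‖T X‖) * q := by rw [← Finset.sum_mul, ← Finset.mul_sum]
    _ ≤ c := by
        rw [hc]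
        gcongr
        exact hsum.trans (by gcongr)

end LiebRobinson

/-! ### Pauli operators and the local cost -/

/-- The identity and the three Pauli matrices. -/
noncomputable def pauli : Fin 4 → Matrix (Fin 2) (Fin 2) ℂ :=
  ![1, !![0, 1; 1, 0], !![0, -Complex.I; Complex.I, 0], !![1, 0; 0, -1]]

theorem pauli_isHermitian (a : Fin 4) : (pauli a).IsHermitian := by
  ext x y
  fin_cases a <;> fin_cases x <;> fin_cases y <;> simp [pauli]

theorem pauli_mul_self (a : Fin 4) : pauli a * pauli a = 1 := by
  ext x y
  fin_cases a <;> fin_cases x <;> fin_cases y <;>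
    simp [pauli, Matrix.mul_apply, Fin.sum_univ_two, Matrix.one_apply]

/-- The projection onto a Bell pair is the average of `P ⊗ P*` over the Pauli matrices `P`. -/
theorem bellPair_mul_star (a b c d : Fin 2) :
    bellPair a b * star (bellPair c d) =
      ∑ m : Fin 4, (1 / 4 : ℂ) * (pauli m a c * star (pauli m b d)) := by
  have h : ((Real.sqrt 2 : ℝ) : ℂ)⁻¹ * ((Real.sqrt 2 : ℝ) : ℂ)⁻¹ = 1 / 2 := by
    rw [← mul_inv, ← Complex.ofReal_mul, Real.mul_self_sqrt (by norm_num)]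
    norm_num
  fin_cases a <;> fin_cases b <;> fin_cases c <;> fin_cases d <;>
    simp [bellPair, pauli, Fin.sum_univ_four, h] <;> norm_num

/-- The Pauli matrix number `a` at the site `j`. -/
noncomputable def pauliSite (j : ℕ) (a : Fin 4) : Op {j} :=
  fun s t => pauli a (s ⟨j, Finset.mem_singleton_self j⟩) (t ⟨j, Finset.mem_singleton_self j⟩)

/-- The configurations of a single site are the two basis states. -/
def singleSiteEquiv (j : ℕ) : Config {j} ≃ Fin 2 :=
  Equiv.funUnique ({j} : Finset ℕ) (Fin 2)

theorem pauliSite_eq_submatrix (j : ℕ) (a : Fin 4) :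
    pauliSite j a = (pauli a).submatrix (singleSiteEquiv j) (singleSiteEquiv j) := rfl

theorem pauliSite_isHermitian (j : ℕ) (a : Fin 4) : (pauliSite j a).IsHermitian := by
  rw [pauliSite_eq_submatrix]
  exact (pauli_isHermitian a).submatrix _

theorem norm_pauliSite (j : ℕ) (a : Fin 4) : ‖pauliSite j a‖ = 1 := by
  have h : pauliSite j a * pauliSite j a = 1 := by
    rw [pauliSite_eq_submatrix, Matrix.submatrix_mul_equiv, pauli_mul_self,
      Matrix.submatrix_one_equiv]
  refine CStarRing.norm_of_mem_unitary (Unitary.mem_iff.2 ?_)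
  rw [(show star (pauliSite j a) = pauliSite j a from pauliSite_isHermitian j a)]
  exact ⟨h, h⟩

theorem pauliSite_zero (j : ℕ) : pauliSite j 0 = 1 := by
  rw [pauliSite_eq_submatrix]
  simp [pauli]

theorem singleton_subset_of_mem {S : Finset ℕ} (j : S) : {(j : ℕ)} ⊆ S :=
  Finset.singleton_subset_iff.2 j.2

theorem bellProj_eq_sum {S : Finset ℕ} (j : S) :
    bellProj j = ∑ a : Fin 4, (1 / 4 : ℂ) •
      (embed (singleton_subset_of_mem j) (pauliSite j a) ⊗ₖ
        (embed (singleton_subset_of_mem j) (pauliSite j a)).map star) := by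
  ext x y
  have hiff : (∀ i, i ≠ j → x.1 i = y.1 i ∧ x.2 i = y.2 i) ↔
      (∀ i : S, (i : ℕ) ∉ ({(j : ℕ)} : Finset ℕ) → x.1 i = y.1 i) ∧
      (∀ i : S, (i : ℕ) ∉ ({(j : ℕ)} : Finset ℕ) → x.2 i = y.2 i) := by
    simp only [Finset.mem_singleton, Subtype.coe_inj, ← forall_and, ne_eq]
  simp only [bellProj, hiff, Matrix.sum_apply, Matrix.smul_apply, Matrix.kroneckerMap_apply,
    Matrix.map_apply, embed, smul_eq_mul]
  by_cases h1 : ∀ i : S, (i : ℕ) ∉ ({(j : ℕ)} : Finset ℕ) → x.1 i = y.1 i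
  · by_cases h2 : ∀ i : S, (i : ℕ) ∉ ({(j : ℕ)} : Finset ℕ) → x.2 i = y.2 i
    · rw [if_pos ⟨h1, h2⟩, bellPair_mul_star]
      simp only [if_pos h1, if_pos h2]
      rfl
    · rw [if_neg fun h => h2 h.2]
      simp only [if_neg h2, star_zero, mul_zero, Finset.sum_const_zero]
  · rw [if_neg fun h => h1 h.1]
    simp only [if_neg h1, zero_mul, mul_zero, Finset.sum_const_zero]

theorem bellState_apply (S : Finset ℕ) (s t : Config S) :
    bellState S (s, t) = if s = t then (1 / (Real.sqrt 2 : ℂ)) ^ S.card else 0 := by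
  unfold bellState bellPair
  split_ifs with h
  · subst h
    simp
  · obtain ⟨i, hi⟩ := Function.ne_iff.1 h
    exact Finset.prod_eq_zero (Finset.mem_univ i) (if_neg hi)

theorem star_bellState (S : Finset ℕ) : star (bellState S) = bellState S := by
  ext ⟨s, t⟩
  rw [Pi.star_apply, bellState_apply]
  split_ifs <;> simp

theorem inv_sqrt_two_pow_mul_self (n : ℕ) :
    (1 / (Real.sqrt 2 : ℂ)) ^ n * (1 / (Real.sqrt 2 : ℂ)) ^ n = (2 ^ n : ℂ)⁻¹ := by
  rw [← mul_pow, ← inv_pow, one_div, ← mul_inv, ← Complex.ofReal_mul,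
    Real.mul_self_sqrt (by norm_num)]
  norm_num

/-- `⟨Φ₊| X ⊗ Y* |Φ₊⟩ = 2^{-|S|} Tr[X Y†]`. -/
theorem bellState_dotProduct_kronecker {S : Finset ℕ} (X Y : Op S) :
    bellState S ⬝ᵥ ((X ⊗ₖ Y.map star).mulVec (bellState S)) =
      normTrace (X * Y.conjTranspose) := by
  have h1 : ∀ (x : Config S × Config S), ((X ⊗ₖ Y.map star).mulVec (bellState S)) x =
      (1 / (Real.sqrt 2 : ℂ)) ^ S.card * ∑ t, X x.1 t * star (Y x.2 t) := by
    intro x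
    rw [Matrix.mulVec, dotProduct, Fintype.sum_prod_type, Finset.mul_sum]
    refine Finset.sum_congr rfl fun t _ => ?_
    rw [Finset.sum_eq_single t]
    · rw [bellState_apply, if_pos rfl, Matrix.kroneckerMap_apply, Matrix.map_apply, mul_comm]
    · intro u _ hu
      rw [bellState_apply, if_neg (Ne.symm hu), mul_zero]
    · simp
  rw [dotProduct, Fintype.sum_prod_type, normTrace, Matrix.trace, Finset.mul_sum]
  refine Finset.sum_congr rfl fun s _ => ?_
  rw [Finset.sum_eq_single s]
  · rw [bellState_apply, if_pos rfl, h1, ← mul_assoc, inv_sqrt_two_pow_mul_self]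
    rfl
  · intro u _ hu
    rw [bellState_apply, if_neg (Ne.symm hu), zero_mul]
  · simp

theorem kronecker_map_star_mul {S : Finset ℕ} (U V X Y : Op S) :
    (U ⊗ₖ V.map star) * (X ⊗ₖ Y.map star) = (U * X) ⊗ₖ (V * Y).map star := by
  rw [← Matrix.mul_kronecker_mul]
  congr 1
  exact (Matrix.map_mul (f := starRingEnd ℂ)).symm

theorem kronecker_map_star_conjTranspose {S : Finset ℕ} (U V : Op S) :
    (U ⊗ₖ V.map star).conjTranspose = U.conjTranspose ⊗ₖ V.conjTranspose.map star := by
  rw [Matrix.conjTranspose_kronecker]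
  rfl

theorem rhoAB_eq_vecMulVec {S : Finset ℕ} (U V : Op S) :
    rhoAB U V = Matrix.vecMulVec ((U ⊗ₖ V.map star).mulVec (bellState S))
      (star ((U ⊗ₖ V.map star).mulVec (bellState S))) := by
  rw [rhoAB, Matrix.mul_vecMulVec, Matrix.vecMulVec_mul, Matrix.star_mulVec]

theorem trace_mul_rhoAB {S : Finset ℕ} (A : Matrix (Config S × Config S) _ ℂ) (U V : Op S) :
    (A * rhoAB U V).trace = star ((U ⊗ₖ V.map star).mulVec (bellState S)) ⬝ᵥ
      A.mulVec ((U ⊗ₖ V.map star).mulVec (bellState S)) := by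
  rw [rhoAB_eq_vecMulVec, Matrix.mul_vecMulVec, Matrix.trace_vecMulVec, dotProduct_comm]

theorem trace_kronecker_mul_rhoAB {S : Finset ℕ} (X Y U V : Op S) :
    ((X ⊗ₖ Y.map star) * rhoAB U V).trace =
      normTrace (heisenberg U X * (heisenberg V Y).conjTranspose) := by
  rw [trace_mul_rhoAB, Matrix.star_mulVec, star_bellState, ← Matrix.dotProduct_mulVec,
    Matrix.mulVec_mulVec, Matrix.mulVec_mulVec, kronecker_map_star_conjTranspose,
    kronecker_map_star_mul, kronecker_map_star_mul, bellState_dotProduct_kronecker]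
  simp only [heisenberg, Matrix.mul_assoc]

/-- The local cost in terms of Heisenberg evolved Pauli operators. -/
theorem costLHSTAt_eq {S : Finset ℕ} (j : S) (U V : Op S) :
    costLHSTAt j U V = 1 - ∑ a : Fin 4, (1 / 4 : ℝ) *
      (normTrace (heisenberg U (embed (singleton_subset_of_mem j) (pauliSite j a)) *
        (heisenberg V (embed (singleton_subset_of_mem j) (pauliSite j a))).conjTranspose)).re := by
  rw [costLHSTAt, bellProj_eq_sum, Finset.sum_mul, Matrix.trace_sum, Complex.re_sum]
  congr 1
  refine Finset.sum_congr rfl fun a _ => ?_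
  rw [Matrix.smul_mul, Matrix.trace_smul, trace_kronecker_mul_rhoAB, smul_eq_mul,
    show (1 / 4 : ℂ) = ((1 / 4 : ℝ) : ℂ) by norm_num, Complex.re_ofReal_mul]

theorem norm_heisenberg {S : Finset ℕ} {U : Op S} (hU : U ∈ Matrix.unitaryGroup (Config S) ℂ)
    (A : Op S) : ‖heisenberg U A‖ = ‖A‖ := by
  unfold heisenberg
  rw [CStarRing.norm_mul_mem_unitary _ hU]
  exact CStarRing.norm_mem_unitary_mul _ (Unitary.star_mem hU)

theorem heisenberg_one {S : Finset ℕ} {U : Op S} (hU : U ∈ Matrix.unitaryGroup (Config S) ℂ) :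
    heisenberg U 1 = 1 := by
  rw [heisenberg, mul_one]
  exact Unitary.star_mul_self_of_mem hU

/-- Only the three non-trivial Pauli matrices distinguish `U` from `U'` in the local cost. -/
theorem costLHSTAt_le_add {S : Finset ℕ} (j : S) {U U' V : Op S}
    (hU : U ∈ Matrix.unitaryGroup (Config S) ℂ) (hU' : U' ∈ Matrix.unitaryGroup (Config S) ℂ)
    (hV : V ∈ Matrix.unitaryGroup (Config S) ℂ) {ε : ℝ}
    (h : ∀ a, ‖heisenberg U (embed (singleton_subset_of_mem j) (pauliSite j a)) -
      heisenberg U' (embed (singleton_subset_of_mem j) (pauliSite j a))‖ ≤ ε) :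
    costLHSTAt j U V ≤ costLHSTAt j U' V + 3 / 4 * ε := by
  have key : ∀ a, (normTrace (heisenberg U' (embed (singleton_subset_of_mem j) (pauliSite j a)) *
        (heisenberg V (embed (singleton_subset_of_mem j) (pauliSite j a))).conjTranspose)).re ≤
      (normTrace (heisenberg U (embed (singleton_subset_of_mem j) (pauliSite j a)) *
        (heisenberg V (embed (singleton_subset_of_mem j) (pauliSite j a))).conjTranspose)).re +
        ε := by
    intro a
    set P := embed (singleton_subset_of_mem j) (pauliSite j a)
    have hP : ‖(heisenberg V P).conjTranspose‖ ≤ 1 := by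
      rw [Matrix.l2_opNorm_conjTranspose, norm_heisenberg hV]
      exact (norm_embed_le _ _).trans_eq (norm_pauliSite _ _)
    have h1 : ‖normTrace ((heisenberg U P - heisenberg U' P) *
        (heisenberg V P).conjTranspose)‖ ≤ ε :=
      (norm_normTrace_le _).trans ((norm_mul_le _ _).trans
        ((mul_le_of_le_one_right (norm_nonneg _) hP).trans (h a)))
    have h2 : normTrace ((heisenberg U P - heisenberg U' P) * (heisenberg V P).conjTranspose) =
        normTrace (heisenberg U P * (heisenberg V P).conjTranspose) -
          normTrace (heisenberg U' P * (heisenberg V P).conjTranspose) := by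
      rw [sub_mul, normTrace, Matrix.trace_sub, mul_sub]
      rfl
    have h3 := (abs_le.1 ((Complex.abs_re_le_norm _).trans h1)).1
    rw [h2, Complex.sub_re] at h3
    linarith
  have h0 : heisenberg U (embed (singleton_subset_of_mem j) (pauliSite j 0)) =
      heisenberg U' (embed (singleton_subset_of_mem j) (pauliSite j 0)) := by
    rw [pauliSite_zero, embed_one, heisenberg_one hU, heisenberg_one hU']
  rw [costLHSTAt_eq, costLHSTAt_eq]
  simp only [Fin.sum_univ_four]
  rw [h0]
  linarith [key 1, key 2, key 3]

/-! ### The union bound for the global cost -/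

/-- The projection onto the Bell pairs of the sites `i ∈ T`. -/
noncomputable def bellProjOn {S : Finset ℕ} (T : Finset S) :
    Matrix (Config S × Config S) (Config S × Config S) ℂ :=
  fun x y => if ∀ i, i ∉ T → x.1 i = y.1 i ∧ x.2 i = y.2 i then
    ∏ i ∈ T, bellPair (x.1 i) (x.2 i) * star (bellPair (y.1 i) (y.2 i)) else 0

theorem bellProjOn_empty (S : Finset ℕ) : bellProjOn (∅ : Finset S) = 1 := by
  ext x y
  have : (∀ i : S, i ∉ (∅ : Finset S) → x.1 i = y.1 i ∧ x.2 i = y.2 i) ↔ x = y := by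
    simp [Prod.ext_iff, funext_iff, forall_and]
  simp only [bellProjOn, this, Finset.prod_empty, Matrix.one_apply]

theorem bellProjOn_univ (S : Finset ℕ) :
    bellProjOn (Finset.univ : Finset S) =
      Matrix.vecMulVec (bellState S) (star (bellState S)) := by
  ext x y
  simp [bellProjOn, Matrix.vecMulVec_apply, bellState, Finset.prod_mul_distrib]

theorem bellProjOn_conjTranspose {S : Finset ℕ} (T : Finset S) :
    (bellProjOn T).conjTranspose = bellProjOn T := by
  ext x y
  rw [Matrix.conjTranspose_apply, bellProjOn, bellProjOn]
  have : (∀ i, i ∉ T → y.1 i = x.1 i ∧ y.2 i = x.2 i) ↔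
      ∀ i, i ∉ T → x.1 i = y.1 i ∧ x.2 i = y.2 i := by simp only [eq_comm]
  simp only [this]
  split_ifs
  · rw [star_prod]
    exact Finset.prod_congr rfl fun i _ => by rw [star_mul, star_star]
  · exact star_zero _

theorem bellProjOn_singleton {S : Finset ℕ} (j : S) : bellProjOn {j} = bellProj j := by
  ext x y
  simp [bellProjOn, bellProj]

theorem bellProj_mul_bellProjOn {S : Finset ℕ} {T : Finset S} {j : S} (hj : j ∉ T) :
    bellProj j * bellProjOn T = bellProjOn (insert j T) := by
  ext x y
  rw [Matrix.mul_apply, Finset.sum_eq_single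
    (Function.update x.1 j (y.1 j), Function.update x.2 j (y.2 j))]
  · have h1 : ∀ i, i ≠ j → x.1 i = (Function.update x.1 j (y.1 j)) i ∧
        x.2 i = (Function.update x.2 j (y.2 j)) i := fun i hi => by simp [hi]
    have h2 : (∀ i, i ∉ T → (Function.update x.1 j (y.1 j)) i = y.1 i ∧
        (Function.update x.2 j (y.2 j)) i = y.2 i) ↔
        ∀ i, i ∉ insert j T → x.1 i = y.1 i ∧ x.2 i = y.2 i := by
      refine forall_congr' fun i => ?_
      by_cases hi : i = j
      · subst hi; simp
      · simp [hi]
    have h3 : ∏ i ∈ T, bellPair (Function.update x.1 j (y.1 j) i)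
        (Function.update x.2 j (y.2 j) i) * star (bellPair (y.1 i) (y.2 i)) =
        ∏ i ∈ T, bellPair (x.1 i) (x.2 i) * star (bellPair (y.1 i) (y.2 i)) :=
      Finset.prod_congr rfl fun i hi => by
        have : i ≠ j := fun h => hj (h ▸ hi)
        simp [this]
    simp only [bellProj, bellProjOn, if_pos h1, h2, h3, Function.update_self,
      Finset.prod_insert hj, mul_ite, mul_zero]
  · intro z _ hz
    simp only [bellProj, bellProjOn]
    split_ifs with h1 h2 <;> try simp
    refine absurd (Prod.ext ?_ ?_) hz
    · funext i
      by_cases hi : i = j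
      · subst hi; simpa using (h2 i hj).1
      · simpa [hi] using (h1 i hi).1.symm
    · funext i
      by_cases hi : i = j
      · subst hi; simpa using (h2 i hj).2
      · simpa [hi] using (h1 i hi).2.symm
  · simp

theorem bellProj_conjTranspose {S : Finset ℕ} (j : S) :
    (bellProj j).conjTranspose = bellProj j := by
  rw [← bellProjOn_singleton, bellProjOn_conjTranspose]

/-- The sum over intermediate states reduces to the states of the pair `j`. -/
theorem bellProj_mul_self {S : Finset ℕ} (j : S) : bellProj j * bellProj j = bellProj j := by
  ext x y
  rw [Matrix.mul_apply, ← Fintype.sum_of_injective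
    (fun c : Fin 2 × Fin 2 => (Function.update x.1 j c.1, Function.update x.2 j c.2))
    (f := fun c => bellProj j x (Function.update x.1 j c.1, Function.update x.2 j c.2) *
      bellProj j (Function.update x.1 j c.1, Function.update x.2 j c.2) y)]
  · have h2 : ∀ c : Fin 2 × Fin 2, (∀ i, i ≠ j → (Function.update x.1 j c.1) i = y.1 i ∧
        (Function.update x.2 j c.2) i = y.2 i) ↔
        ∀ i, i ≠ j → x.1 i = y.1 i ∧ x.2 i = y.2 i := fun c =>
      forall_congr' fun i => forall_congr' fun hi => by simp [hi]
    have h1 : ∀ c : Fin 2 × Fin 2, ∀ i, i ≠ j → x.1 i = (Function.update x.1 j c.1) i ∧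
        x.2 i = (Function.update x.2 j c.2) i := fun c i hi => by simp [hi]
    simp only [bellProj, if_pos (h1 _), h2, Function.update_self]
    split_ifs
    · have hs : ∑ c : Fin 2 × Fin 2, star (bellPair c.1 c.2) * bellPair c.1 c.2 = 1 := by
        have h : ((Real.sqrt 2 : ℝ) : ℂ)⁻¹ * ((Real.sqrt 2 : ℝ) : ℂ)⁻¹ = 1 / 2 := by
          rw [← mul_inv, ← Complex.ofReal_mul, Real.mul_self_sqrt (by norm_num)]
          norm_num
        simp [Fintype.sum_prod_type, bellPair, h]
      calc _ = bellPair (x.1 j) (x.2 j) * (∑ c : Fin 2 × Fin 2,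
            star (bellPair c.1 c.2) * bellPair c.1 c.2) * star (bellPair (y.1 j) (y.2 j)) := by
            rw [Finset.mul_sum, Finset.sum_mul]
            exact Finset.sum_congr rfl fun c _ => by ring
        _ = _ := by rw [hs, mul_one]
    · simp
  · intro c c' h
    have h1 := congrFun (Prod.ext_iff.1 h).1 j
    have h2 := congrFun (Prod.ext_iff.1 h).2 j
    simp only [Function.update_self] at h1 h2
    exact Prod.ext h1 h2
  · intro z hz
    have : ¬ ∀ i, i ≠ j → x.1 i = z.1 i ∧ x.2 i = z.2 i := fun h => hz
      ⟨(z.1 j, z.2 j), Prod.ext (funext fun i => by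
        by_cases hi : i = j
        · subst hi; simp
        · simpa [hi] using (h i hi).1) (funext fun i => by
        by_cases hi : i = j
        · subst hi; simp
        · simpa [hi] using (h i hi).2)⟩
    rw [bellProj, if_neg this, zero_mul]
  · exact fun c => rfl

theorem bellProj_commute_bellProjOn {S : Finset ℕ} {T : Finset S} {j : S} (hj : j ∉ T) :
    Commute (bellProj j) (bellProjOn T) := by
  have h := congrArg Matrix.conjTranspose (bellProj_mul_bellProjOn hj)
  rw [Matrix.conjTranspose_mul, bellProj_conjTranspose, bellProjOn_conjTranspose,
    bellProjOn_conjTranspose] at h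
  exact (bellProj_mul_bellProjOn hj).trans h.symm

theorem bellProjOn_mul_self {S : Finset ℕ} (T : Finset S) :
    bellProjOn T * bellProjOn T = bellProjOn T := by
  induction T using Finset.induction_on with
  | empty => rw [bellProjOn_empty, mul_one]
  | insert j T hj ih =>
    rw [← bellProj_mul_bellProjOn hj, (bellProj_commute_bellProjOn hj).symm.mul_mul_mul_comm, ih,
      bellProj_mul_self]

open scoped ComplexOrder in
/-- Union bound for the commuting projections onto the Bell pairs: with `p` and `q` two of
them, `(1 - p) + (1 - q) - (1 - p q) = (1 - p) (1 - q)` is a projection. -/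
theorem posSemidef_union_bound {S : Finset ℕ} (T : Finset S) :
    (∑ j ∈ T, (1 - bellProj j) - (1 - bellProjOn T)).PosSemidef := by
  induction T using Finset.induction_on with
  | empty =>
    rw [bellProjOn_empty, Finset.sum_empty, sub_self, sub_zero]
    exact Matrix.PosSemidef.zero
  | insert j T hj ih =>
    have hc := bellProj_commute_bellProjOn hj
    set p := bellProj j with hp
    set q := bellProjOn T with hq
    have h1 : ((1 - p) * (1 - q)).conjTranspose * ((1 - p) * (1 - q)) = (1 - p) * (1 - q) := by
      have hc' : Commute (1 - p) (1 - q) :=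
        ((Commute.one_left _).sub_left ((Commute.one_right _).sub_right hc))
      have hpp : (1 - p) * (1 - p) = 1 - p := by
        rw [mul_sub, mul_one, sub_mul, one_mul, bellProj_mul_self, sub_self, sub_zero]
      have hqq : (1 - q) * (1 - q) = 1 - q := by
        rw [mul_sub, mul_one, sub_mul, one_mul, bellProjOn_mul_self, sub_self, sub_zero]
      rw [Matrix.conjTranspose_mul, Matrix.conjTranspose_sub, Matrix.conjTranspose_sub,
        Matrix.conjTranspose_one, bellProj_conjTranspose, bellProjOn_conjTranspose, ← hc'.eq,
        hc'.symm.mul_mul_mul_comm, hpp, hqq]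
    have h2 : ((1 - p) * (1 - q)).PosSemidef := h1 ▸ Matrix.posSemidef_conjTranspose_mul_self _
    have h3 : ∑ j ∈ insert j T, (1 - bellProj j) - (1 - bellProjOn (insert j T)) =
        (∑ j ∈ T, (1 - bellProj j) - (1 - q)) + (1 - p) * (1 - q) := by
      rw [Finset.sum_insert hj, ← bellProj_mul_bellProjOn hj]
      noncomm_ring
    rw [h3]
    exact ih.add h2

theorem trace_rhoAB {S : Finset ℕ} {U V : Op S} (hU : U ∈ Matrix.unitaryGroup (Config S) ℂ)
    (hV : V ∈ Matrix.unitaryGroup (Config S) ℂ) : (rhoAB U V).trace = 1 := by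
  have h := trace_kronecker_mul_rhoAB 1 1 U V
  have h1 : (1 : Op S) ⊗ₖ (1 : Op S).map star = 1 := by
    rw [Matrix.map_one _ (star_zero _) (star_one _), Matrix.one_kronecker_one]
  rw [h1, one_mul, heisenberg_one hU, heisenberg_one hV, Matrix.conjTranspose_one, one_mul] at h
  rw [h, normTrace, Matrix.trace_one, card_config]
  push_cast
  exact inv_mul_cancel₀ (pow_ne_zero _ two_ne_zero)

/-- The overlap with the Bell pairs of all the sites is `|2^{-|S|} Tr[U† V]|²`. -/
theorem costHST_eq {S : Finset ℕ} (U V : Op S) :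
    costHST U V = 1 - (bellProjOn Finset.univ * rhoAB U V).trace.re := by
  have h1 : (bellProjOn Finset.univ * rhoAB U V).trace =
      normTrace (U * V.conjTranspose) * star (normTrace (U * V.conjTranspose)) := by
    rw [trace_mul_rhoAB, bellProjOn_univ, Matrix.vecMulVec_mulVec, star_bellState,
      bellState_dotProduct_kronecker, op_smul_eq_smul, dotProduct_smul, Matrix.star_dotProduct,
      star_bellState, bellState_dotProduct_kronecker, smul_eq_mul]
  have h2 : ‖(U * V.conjTranspose).trace‖ = ‖(U.conjTranspose * V).trace‖ := by
    rw [← norm_star, ← Matrix.trace_conjTranspose, Matrix.conjTranspose_mul,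
      Matrix.conjTranspose_conjTranspose, Matrix.trace_mul_comm]
  rw [costHST, h1, Complex.star_def, Complex.mul_conj, Complex.ofReal_re, Complex.normSq_eq_norm_sq,
    normTrace, norm_mul, h2, norm_inv, norm_pow, Complex.norm_ofNat, mul_pow, inv_pow, ← pow_mul,
    mul_comm S.card 2, pow_mul]
  norm_num
  ring

open scoped ComplexOrder in
/-- The global cost is at most the sum of the local costs. -/
theorem costHST_le_sum {S : Finset ℕ} {U V : Op S} (hU : U ∈ Matrix.unitaryGroup (Config S) ℂ)
    (hV : V ∈ Matrix.unitaryGroup (Config S) ℂ) :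
    costHST U V ≤ ∑ j : S, costLHSTAt j U V := by
  have h := (posSemidef_union_bound (Finset.univ : Finset S)).re_dotProduct_nonneg
    ((U ⊗ₖ V.map star).mulVec (bellState S))
  rw [← trace_mul_rhoAB] at h
  simp only [sub_mul, one_mul, Finset.sum_mul, Matrix.trace_sub, Matrix.trace_sum,
    trace_rhoAB hU hV, map_sub, map_sum, RCLike.re_to_complex, Complex.one_re] at h
  rw [costHST_eq]
  unfold costLHSTAt
  linarith

/-! ### Haar random states -/

section Haar

open MeasureTheory

/-- The action of a linear isometry on the unit sphere. -/
def sphereMap {E : Type*} [NormedAddCommGroup E] [NormedSpace ℝ E] (e : E ≃ₗᵢ[ℝ] E) :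
    Metric.sphere (0 : E) 1 → Metric.sphere (0 : E) 1 :=
  fun x => ⟨e x, by simp⟩

theorem continuous_sphereMap {E : Type*} [NormedAddCommGroup E] [NormedSpace ℝ E]
    (e : E ≃ₗᵢ[ℝ] E) : Continuous (sphereMap e) :=
  Continuous.subtype_mk (e.continuous.comp continuous_subtype_val) _

/-- A linear isometry preserves Haar measure, its determinant being determined by the image of
the unit ball. -/
theorem addHaar_preimage_isometry {E : Type*} [NormedAddCommGroup E] [NormedSpace ℝ E]
    [MeasurableSpace E] [BorelSpace E] [FiniteDimensional ℝ E] (μ : Measure E)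
    [μ.IsAddHaarMeasure] (e : E ≃ₗᵢ[ℝ] E) (s : Set E) : μ (e ⁻¹' s) = μ s := by
  have h : ∀ s : Set E, μ (e ⁻¹' s) = _ :=
    fun s => Measure.addHaar_preimage_linearEquiv μ e.toLinearEquiv s
  have hb := h (Metric.ball 0 1)
  rw [e.preimage_ball, map_zero] at hb
  have h0 : μ (Metric.ball (0 : E) 1) ≠ 0 := (Metric.measure_ball_pos μ 0 one_pos).ne'
  have h1 : μ (Metric.ball (0 : E) 1) ≠ ⊤ := measure_ball_lt_top.ne
  have h2 := (ENNReal.mul_eq_right h0 h1).1 hb.symm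
  rw [h, h2, one_mul]

open scoped Pointwise in
theorem map_sphereMap_toSphere {E : Type*} [NormedAddCommGroup E] [NormedSpace ℝ E]
    [MeasurableSpace E] [BorelSpace E] [FiniteDimensional ℝ E] (μ : Measure E)
    [μ.IsAddHaarMeasure] (e : E ≃ₗᵢ[ℝ] E) : μ.toSphere.map (sphereMap e) = μ.toSphere := by
  have hm : Measurable (sphereMap e) := (continuous_sphereMap e).measurable
  ext s hs
  rw [Measure.map_apply hm hs, Measure.toSphere_apply' _ hs, Measure.toSphere_apply' _ (hm hs),
    ← addHaar_preimage_isometry μ e (Set.Ioo (0 : ℝ) 1 • (Subtype.val '' s))]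
  congr 2
  ext x
  simp only [Set.mem_smul, Set.mem_image, Set.mem_preimage]
  constructor
  · rintro ⟨r, hr, _, ⟨y, hy, rfl⟩, rfl⟩
    exact ⟨r, hr, _, ⟨sphereMap e y, hy, rfl⟩, by simp [sphereMap]⟩
  · rintro ⟨r, hr, _, ⟨y, hy, rfl⟩, hxy⟩
    refine ⟨r, hr, e.symm y, ⟨sphereMap e.symm y, ?_, rfl⟩, ?_⟩
    · simpa [sphereMap] using hy
    · rw [← map_smul, hxy, e.symm_apply_apply]

variable (ι : Type*) [Fintype ι]

/-- The normalized surface measure on the unit sphere of `ℂ^ι`. -/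
noncomputable def haarSphere : Measure (Metric.sphere (0 : EuclideanSpace ℂ ι) 1) :=
  ((Measure.addHaar : Measure (EuclideanSpace ℂ ι)).toSphere Set.univ)⁻¹ •
    (Measure.addHaar : Measure (EuclideanSpace ℂ ι)).toSphere

instance isProbabilityMeasure_haarSphere [Nonempty ι] : IsProbabilityMeasure (haarSphere ι) := by
  have : NeZero (Measure.addHaar : Measure (EuclideanSpace ℂ ι)).toSphere :=
    ⟨Measure.toSphere_ne_zero _⟩
  unfold haarSphere
  infer_instance

variable {ι}

theorem map_sphereMap_haarSphere (e : EuclideanSpace ℂ ι ≃ₗᵢ[ℝ] EuclideanSpace ℂ ι) :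
    (haarSphere ι).map (sphereMap e) = haarSphere ι := by
  rw [haarSphere, Measure.map_smul, map_sphereMap_toSphere]

theorem integrable_haarSphere [Nonempty ι] {f : Metric.sphere (0 : EuclideanSpace ℂ ι) 1 → ℝ}
    (hf : Continuous f) : Integrable f (haarSphere ι) :=
  hf.integrable_of_hasCompactSupport (HasCompactSupport.of_compactSpace f)

theorem continuous_norm_inner (u : EuclideanSpace ℂ ι) :
    Continuous fun ψ : Metric.sphere (0 : EuclideanSpace ℂ ι) 1 => ‖inner ℂ u ψ.1‖ :=
  (continuous_const.inner continuous_subtype_val).norm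

/-- The fourth moment `∫ |⟨u, ψ⟩|⁴ dψ` is the same for all unit vectors `u`. -/
theorem integral_norm_inner_pow_four [DecidableEq ι] (i : ι) {u : EuclideanSpace ℂ ι}
    (hu : ‖u‖ = 1) :
    ∫ ψ, ‖inner ℂ u ψ.1‖ ^ 4 ∂haarSphere ι = ∫ ψ, ‖ψ.1 i‖ ^ 4 ∂haarSphere ι := by
  -- Complete `u` to an orthonormal basis; passing to its coordinates is a unitary map.
  obtain ⟨b, hb⟩ := Orthonormal.exists_orthonormalBasis_extension_of_card_eq (𝕜 := ℂ)
    (E := EuclideanSpace ℂ ι) (ι := ι) (by simp) (v := fun _ => u) (s := {i})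
    (by
      rw [orthonormal_iff_ite]
      rintro ⟨a, rfl⟩ ⟨c, rfl⟩
      simp [inner_self_eq_norm_sq_to_K, hu])
  have hbi : b i = u := hb i rfl
  set e : EuclideanSpace ℂ ι ≃ₗᵢ[ℝ] EuclideanSpace ℂ ι :=
    { b.repr.toLinearEquiv.restrictScalars ℝ with norm_map' := b.repr.norm_map } with he
  have hc : Continuous fun ψ : Metric.sphere (0 : EuclideanSpace ℂ ι) 1 => ‖ψ.1 i‖ ^ 4 := by
    fun_prop
  have key := integral_map (μ := haarSphere ι) (φ := sphereMap e)
    (continuous_sphereMap e).measurable.aemeasurable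
    (f := fun ψ => ‖ψ.1 i‖ ^ 4) hc.aestronglyMeasurable
  rw [map_sphereMap_haarSphere] at key
  rw [key]
  refine integral_congr_ae (Filter.Eventually.of_forall fun ψ => ?_)
  have : (sphereMap e ψ).1 i = inner ℂ u ψ.1 := by
    rw [← hbi, ← b.repr_apply_apply]
    rfl
  simp only [this]

variable [Nonempty ι]

/-- The mixed moment `∫ |⟨u, ψ⟩|² |⟨v, ψ⟩|² dψ` of orthonormal vectors is half of the fourth
moment: average the fourth moments of `(u + c v) / √2` over the fourth roots of unity `c`. -/
theorem integral_norm_inner_sq_mul_sq [DecidableEq ι] (i : ι) {u v : EuclideanSpace ℂ ι}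
    (hu : ‖u‖ = 1) (hv : ‖v‖ = 1) (huv : inner ℂ u v = 0) :
    ∫ ψ, ‖inner ℂ u ψ.1‖ ^ 2 * ‖inner ℂ v ψ.1‖ ^ 2 ∂haarSphere ι =
      (∫ ψ, ‖ψ.1 i‖ ^ 4 ∂haarSphere ι) / 2 := by
  set A := ∫ ψ, ‖ψ.1 i‖ ^ 4 ∂haarSphere ι with hA
  have hcu := continuous_norm_inner u
  have hcv := continuous_norm_inner v
  have hw : ∀ c : ℂ, ‖c‖ = 1 → ∫ ψ, ‖inner ℂ (u + c • v) ψ.1‖ ^ 4 ∂haarSphere ι = 4 * A := by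
    intro c hc
    have h2 : ‖u + c • v‖ ^ 2 = 2 := by
      have := norm_add_sq_eq_norm_sq_add_norm_sq_of_inner_eq_zero (𝕜 := ℂ) u (c • v)
        (by rw [inner_smul_right, huv, mul_zero])
      rw [sq, this, norm_smul, hc, hu, hv]
      norm_num
    have hs : ‖u + c • v‖ = Real.sqrt 2 := by
      rw [← h2, Real.sqrt_sq (norm_nonneg _)]
    have hs0 : Real.sqrt 2 ≠ 0 := by positivity
    have h3 := integral_norm_inner_pow_four i
      (u := (((Real.sqrt 2)⁻¹ : ℝ) : ℂ) • (u + c • v)) (by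
        rw [norm_smul, hs, Complex.norm_real, norm_inv, Real.norm_of_nonneg (Real.sqrt_nonneg 2),
          inv_mul_cancel₀ hs0])
    rw [← hA] at h3
    have h4 : (fun ψ : Metric.sphere (0 : EuclideanSpace ℂ ι) 1 =>
        ‖inner ℂ ((((Real.sqrt 2)⁻¹ : ℝ) : ℂ) • (u + c • v)) ψ.1‖ ^ 4) =
        fun ψ => (1 / 4) * ‖inner ℂ (u + c • v) ψ.1‖ ^ 4 := by
      funext ψ
      rw [inner_smul_left, norm_mul, mul_pow, RCLike.norm_conj, Complex.norm_real, norm_inv,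
        Real.norm_of_nonneg (Real.sqrt_nonneg 2), inv_pow,
        show (4 : ℕ) = 2 * 2 from rfl, pow_mul, Real.sq_sqrt (by norm_num),
        show ((2 : ℝ) ^ 2)⁻¹ = 1 / 4 by norm_num]
    rw [h4, integral_const_mul] at h3
    linarith
  have hid : ∀ x y : ℂ, ‖x + y‖ ^ 4 + ‖x - y‖ ^ 4 + ‖x + Complex.I * y‖ ^ 4 +
      ‖x - Complex.I * y‖ ^ 4 = 4 * ‖x‖ ^ 4 + 4 * ‖y‖ ^ 4 + 16 * (‖x‖ ^ 2 * ‖y‖ ^ 2) := by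
    intro x y
    simp only [show (4 : ℕ) = 2 * 2 from rfl, pow_mul, Complex.sq_norm, Complex.normSq_apply]
    simp only [Complex.add_re, Complex.add_im, Complex.sub_re, Complex.sub_im, Complex.mul_re,
      Complex.mul_im, Complex.I_re, Complex.I_im]
    ring
  have hcc : ∀ c : ℂ, Integrable (fun ψ : Metric.sphere (0 : EuclideanSpace ℂ ι) 1 =>
      ‖inner ℂ (u + c • v) ψ.1‖ ^ 4) (haarSphere ι) := fun c =>
    integrable_haarSphere ((continuous_norm_inner _).pow 4)
  have hsum : ∫ ψ, (‖inner ℂ (u + (1 : ℂ) • v) ψ.1‖ ^ 4 + ‖inner ℂ (u + (-1 : ℂ) • v) ψ.1‖ ^ 4 +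
      ‖inner ℂ (u + (-Complex.I) • v) ψ.1‖ ^ 4 + ‖inner ℂ (u + Complex.I • v) ψ.1‖ ^ 4)
        ∂haarSphere ι =
      ∫ ψ, (4 * ‖inner ℂ u ψ.1‖ ^ 4 + 4 * ‖inner ℂ v ψ.1‖ ^ 4 +
        16 * (‖inner ℂ u ψ.1‖ ^ 2 * ‖inner ℂ v ψ.1‖ ^ 2)) ∂haarSphere ι := by
    refine integral_congr_ae (Filter.Eventually.of_forall fun ψ => ?_)
    have := hid (inner ℂ u ψ.1) (inner ℂ v ψ.1)
    simp only [inner_add_left, inner_smul_left, map_neg, map_one, Complex.conj_I, neg_neg,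
      one_mul, neg_mul, ← sub_eq_add_neg]
    exact this
  have i1 : Integrable (fun ψ : Metric.sphere (0 : EuclideanSpace ℂ ι) 1 =>
      ‖inner ℂ u ψ.1‖ ^ 4) (haarSphere ι) := integrable_haarSphere (hcu.pow 4)
  have i2 : Integrable (fun ψ : Metric.sphere (0 : EuclideanSpace ℂ ι) 1 =>
      ‖inner ℂ v ψ.1‖ ^ 4) (haarSphere ι) := integrable_haarSphere (hcv.pow 4)
  have i3 : Integrable (fun ψ : Metric.sphere (0 : EuclideanSpace ℂ ι) 1 =>
      ‖inner ℂ u ψ.1‖ ^ 2 * ‖inner ℂ v ψ.1‖ ^ 2) (haarSphere ι) :=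
    integrable_haarSphere ((hcu.pow 2).mul (hcv.pow 2))
  have j1 : Integrable (fun ψ : Metric.sphere (0 : EuclideanSpace ℂ ι) 1 =>
      ‖inner ℂ (u + (1 : ℂ) • v) ψ.1‖ ^ 4 + ‖inner ℂ (u + (-1 : ℂ) • v) ψ.1‖ ^ 4)
      (haarSphere ι) := (hcc 1).add (hcc (-1))
  have j2 : Integrable (fun ψ : Metric.sphere (0 : EuclideanSpace ℂ ι) 1 =>
      ‖inner ℂ (u + (1 : ℂ) • v) ψ.1‖ ^ 4 + ‖inner ℂ (u + (-1 : ℂ) • v) ψ.1‖ ^ 4 +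
        ‖inner ℂ (u + (-Complex.I) • v) ψ.1‖ ^ 4) (haarSphere ι) := j1.add (hcc (-Complex.I))
  have j3 : Integrable (fun ψ : Metric.sphere (0 : EuclideanSpace ℂ ι) 1 =>
      4 * ‖inner ℂ u ψ.1‖ ^ 4 + 4 * ‖inner ℂ v ψ.1‖ ^ 4) (haarSphere ι) :=
    (i1.const_mul 4).add (i2.const_mul 4)
  rw [integral_add j2 (hcc Complex.I), integral_add j1 (hcc (-Complex.I)),
    integral_add (hcc 1) (hcc (-1)),
    hw 1 (by simp), hw (-1) (by simp), hw (-Complex.I) (by simp), hw Complex.I (by simp),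
    integral_add j3 (i3.const_mul 16),
    integral_add (i1.const_mul 4) (i2.const_mul 4), integral_const_mul, integral_const_mul,
    integral_const_mul, integral_norm_inner_pow_four i hu, integral_norm_inner_pow_four i hv,
    ← hA] at hsum
  linarith

/-- The second moment of an observable diagonal in an orthonormal basis `b`. -/
theorem integral_basis_moment [DecidableEq ι] (i : ι)
    (b : OrthonormalBasis ι ℂ (EuclideanSpace ℂ ι)) (x : ι → ℝ) :
    ∫ ψ, (∑ a, x a * ‖inner ℂ (b a) ψ.1‖ ^ 2) ^ 2 ∂haarSphere ι =
      (∫ ψ, ‖ψ.1 i‖ ^ 4 ∂haarSphere ι) / 2 * ((∑ a, x a) ^ 2 + ∑ a, x a ^ 2) := by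
  set A := ∫ ψ, ‖ψ.1 i‖ ^ 4 ∂haarSphere ι with hA
  have hM : ∀ a c, ∫ ψ, ‖inner ℂ (b a) ψ.1‖ ^ 2 * ‖inner ℂ (b c) ψ.1‖ ^ 2 ∂haarSphere ι =
      A / 2 * (1 + if a = c then 1 else 0) := by
    intro a c
    split_ifs with h
    · subst h
      rw [show A / 2 * (1 + 1) = A by ring, hA,
        ← integral_norm_inner_pow_four i (b.orthonormal.norm_eq_one a)]
      refine integral_congr_ae (Filter.Eventually.of_forall fun ψ => ?_)
      simp only
      ring
    · rw [integral_norm_inner_sq_mul_sq i (b.orthonormal.norm_eq_one a)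
        (b.orthonormal.norm_eq_one c) (b.orthonormal.inner_eq_zero h), add_zero, mul_one]
  have hi : ∀ a c, Integrable (fun ψ : Metric.sphere (0 : EuclideanSpace ℂ ι) 1 =>
      x a * x c * (‖inner ℂ (b a) ψ.1‖ ^ 2 * ‖inner ℂ (b c) ψ.1‖ ^ 2)) (haarSphere ι) :=
    fun a c => (integrable_haarSphere (((continuous_norm_inner _).pow 2).mul
      ((continuous_norm_inner _).pow 2))).const_mul _
  have hexp : ∀ ψ : Metric.sphere (0 : EuclideanSpace ℂ ι) 1,
      (∑ a, x a * ‖inner ℂ (b a) ψ.1‖ ^ 2) ^ 2 =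
      ∑ a, ∑ c, x a * x c * (‖inner ℂ (b a) ψ.1‖ ^ 2 * ‖inner ℂ (b c) ψ.1‖ ^ 2) := fun ψ => by
    rw [sq, Finset.sum_mul_sum]
    exact Finset.sum_congr rfl fun a _ => Finset.sum_congr rfl fun c _ => by ring
  simp only [hexp]
  rw [integral_finsetSum _ fun a _ => integrable_finsetSum _ fun c _ => hi a c]
  have : ∀ a, ∫ ψ, ∑ c, x a * x c * (‖inner ℂ (b a) ψ.1‖ ^ 2 * ‖inner ℂ (b c) ψ.1‖ ^ 2)
      ∂haarSphere ι = A / 2 * (x a * ∑ c, x c + x a ^ 2) := fun a => by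
    rw [integral_finsetSum _ fun c _ => hi a c]
    simp only [integral_const_mul, hM]
    have : ∀ c, x a * x c * (A / 2 * (1 + if a = c then 1 else 0)) =
        A / 2 * (x a * x c) + if a = c then A / 2 * (x a * x c) else 0 := fun c => by
      split_ifs <;> ring
    rw [Finset.sum_congr rfl fun c _ => this c]
    simp only [Finset.sum_add_distrib, Finset.sum_ite_eq, Finset.mem_univ, if_true,
      Finset.mul_sum, mul_add, sq]
  simp only [this]
  rw [← Finset.mul_sum, Finset.sum_add_distrib, ← Finset.sum_mul]
  ring

/-- The normalization `∑ᵢ |ψᵢ|² = 1` fixes the value of the fourth moment. -/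
theorem fourth_moment [DecidableEq ι] (i : ι) :
    (∫ ψ, ‖ψ.1 i‖ ^ 4 ∂haarSphere ι) / 2 =
      1 / ((Fintype.card ι : ℝ) * (Fintype.card ι + 1)) := by
  have h := integral_basis_moment i (EuclideanSpace.basisFun ι ℂ) fun _ => 1
  have h1 : ∀ ψ : Metric.sphere (0 : EuclideanSpace ℂ ι) 1,
      (∑ a, 1 * ‖inner ℂ (EuclideanSpace.basisFun ι ℂ a) ψ.1‖ ^ 2) ^ 2 = 1 := fun ψ => by
    simp only [one_mul]
    rw [OrthonormalBasis.sum_sq_norm_inner_right, norm_eq_of_mem_sphere]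
    norm_num
  simp only [h1, integral_const, probReal_univ, one_smul, one_pow,
    Finset.sum_const, Finset.card_univ, nsmul_eq_mul, mul_one] at h
  have hn : (0 : ℝ) < Fintype.card ι := by exact_mod_cast Fintype.card_pos
  rw [eq_div_iff (by positivity)]
  linear_combination -h

/-- The second moment of the expectation value of a Hermitian matrix in a Haar random state. -/
theorem integral_expectation_sq [DecidableEq ι] {H : Matrix ι ι ℂ} (hH : H.IsHermitian) :
    ∫ ψ : Metric.sphere (0 : EuclideanSpace ℂ ι) 1,
      (inner ℂ ψ.1 (Matrix.toEuclideanCLM (𝕜 := ℂ) H ψ.1)).re ^ 2 ∂haarSphere ι =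
      1 / ((Fintype.card ι : ℝ) * (Fintype.card ι + 1)) *
        (H.trace.re ^ 2 + (H * H).trace.re) := by
  have hb : ∀ a, Matrix.toEuclideanCLM (𝕜 := ℂ) H (hH.eigenvectorBasis a) =
      (hH.eigenvalues a : ℂ) • hH.eigenvectorBasis a := fun a => by
    have := hH.mulVec_eigenvectorBasis a
    ext k
    simpa using congrFun this k
  have hsa : ∀ x y, inner ℂ (Matrix.toEuclideanCLM (𝕜 := ℂ) H x) y =
      inner ℂ x (Matrix.toEuclideanCLM (𝕜 := ℂ) H y) := by
    intro x y
    have : star (Matrix.toEuclideanCLM (n := ι) (𝕜 := ℂ) H) =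
        Matrix.toEuclideanCLM (𝕜 := ℂ) H := by
      rw [← map_star]
      exact congrArg _ hH
    rw [← ContinuousLinearMap.adjoint_inner_right, ← ContinuousLinearMap.star_eq_adjoint, this]
  have hexp : ∀ ψ : EuclideanSpace ℂ ι, (inner ℂ ψ (Matrix.toEuclideanCLM (𝕜 := ℂ) H ψ)).re =
      ∑ a, hH.eigenvalues a * ‖inner ℂ (hH.eigenvectorBasis a) ψ‖ ^ 2 := fun ψ => by
    rw [← hH.eigenvectorBasis.sum_inner_mul_inner, Complex.re_sum]
    refine Finset.sum_congr rfl fun a _ => ?_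
    rw [← hsa, hb, inner_smul_left, Complex.conj_ofReal, ← inner_conj_symm ψ, mul_left_comm,
      RCLike.conj_mul, Complex.re_ofReal_mul]
    norm_cast
  have ht : H.trace.re = ∑ a, hH.eigenvalues a := by
    rw [hH.trace_eq_sum_eigenvalues]; simp
  have ht2 : (H * H).trace.re = ∑ a, hH.eigenvalues a ^ 2 := by
    have h := hH.spectral_theorem
    have h2 : H * H = Unitary.conjStarAlgAut ℂ _ hH.eigenvectorUnitary
        (Matrix.diagonal (RCLike.ofReal ∘ hH.eigenvalues) *
          Matrix.diagonal (RCLike.ofReal ∘ hH.eigenvalues)) := by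
      rw [map_mul, ← h]
    rw [h2, Unitary.conjStarAlgAut_apply, Matrix.trace_mul_comm, ← mul_assoc,
      Unitary.coe_star_mul_self, one_mul, Matrix.diagonal_mul_diagonal, Matrix.trace_diagonal,
      Complex.re_sum]
    exact Finset.sum_congr rfl fun a _ => by simp [sq]
  obtain ⟨i⟩ := ‹Nonempty ι›
  simp only [hexp]
  rw [integral_basis_moment i, fourth_moment, ht, ht2]

/-- The average gate fidelity of a unitary `M` with the identity is determined by its trace. -/
theorem integral_norm_expectation_sq [DecidableEq ι] {M : Matrix ι ι ℂ}
    (hM : M ∈ Matrix.unitaryGroup ι ℂ) :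
    ∫ ψ : Metric.sphere (0 : EuclideanSpace ℂ ι) 1,
      ‖inner ℂ ψ.1 (Matrix.toEuclideanCLM (𝕜 := ℂ) M ψ.1)‖ ^ 2 ∂haarSphere ι =
      1 / ((Fintype.card ι : ℝ) * (Fintype.card ι + 1)) *
        (‖M.trace‖ ^ 2 + Fintype.card ι) := by
  obtain ⟨H, hHdef⟩ : ∃ H, H = (1 / 2 : ℂ) • (M + M.conjTranspose) := ⟨_, rfl⟩
  obtain ⟨K, hKdef⟩ : ∃ K, K = (-Complex.I / 2 : ℂ) • (M - M.conjTranspose) := ⟨_, rfl⟩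
  have hH : H.IsHermitian := by
    rw [Matrix.IsHermitian, hHdef, Matrix.conjTranspose_smul, Matrix.conjTranspose_add,
      Matrix.conjTranspose_conjTranspose, add_comm]
    congr 1
    simp
  have hK : K.IsHermitian := by
    rw [Matrix.IsHermitian, hKdef, Matrix.conjTranspose_smul, Matrix.conjTranspose_sub,
      Matrix.conjTranspose_conjTranspose, ← neg_sub M, smul_neg, ← neg_smul]
    congr 1
    simp [neg_div]
  have hMHK : M = H + Complex.I • K := by
    rw [hHdef, hKdef, smul_smul, show Complex.I * (-Complex.I / 2) = 1 / 2 by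
      rw [← mul_div_assoc, mul_neg, Complex.I_mul_I, neg_neg], ← smul_add]
    rw [add_add_sub_cancel, ← two_smul ℂ M, smul_smul]
    norm_num
  have hre : ∀ {B : Matrix ι ι ℂ}, B.IsHermitian → ∀ x,
      (inner ℂ x (Matrix.toEuclideanCLM (𝕜 := ℂ) B x)).im = 0 := by
    intro B hB x
    have : star (Matrix.toEuclideanCLM (n := ι) (𝕜 := ℂ) B) =
        Matrix.toEuclideanCLM (𝕜 := ℂ) B := by
      rw [← map_star]
      exact congrArg _ hB
    rw [← Complex.conj_eq_iff_im]
    rw [inner_conj_symm, ← ContinuousLinearMap.adjoint_inner_right,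
      ← ContinuousLinearMap.star_eq_adjoint, this]
  have htr : ∀ {B : Matrix ι ι ℂ}, B.IsHermitian → B.trace.im = 0 := by
    intro B hB
    rw [← Complex.conj_eq_iff_im, ← Complex.star_def, ← Matrix.trace_conjTranspose, hB]
  have hsplit : ∀ z w : ℂ, z.im = 0 → w.im = 0 →
      ‖z + Complex.I * w‖ ^ 2 = z.re ^ 2 + w.re ^ 2 := by
    intro z w hz hw
    rw [Complex.sq_norm, Complex.normSq_apply]
    simp [hz, hw]
    ring
  have hψ : ∀ x : EuclideanSpace ℂ ι, ‖inner ℂ x (Matrix.toEuclideanCLM (𝕜 := ℂ) M x)‖ ^ 2 =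
      (inner ℂ x (Matrix.toEuclideanCLM (𝕜 := ℂ) H x)).re ^ 2 +
        (inner ℂ x (Matrix.toEuclideanCLM (𝕜 := ℂ) K x)).re ^ 2 := by
    intro x
    rw [← hsplit _ _ (hre hH x) (hre hK x), hMHK, map_add, map_smul,
      add_apply, smul_apply, inner_add_right,
      inner_smul_right]
  have hint : ∀ B : Matrix ι ι ℂ, Integrable
      (fun ψ : Metric.sphere (0 : EuclideanSpace ℂ ι) 1 =>
        (inner ℂ ψ.1 (Matrix.toEuclideanCLM (𝕜 := ℂ) B ψ.1)).re ^ 2) (haarSphere ι) := fun B =>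
    integrable_haarSphere ((Complex.continuous_re.comp (continuous_subtype_val.inner
      ((Matrix.toEuclideanCLM (𝕜 := ℂ) B).continuous.comp continuous_subtype_val))).pow 2)
  have h1 : ‖M.trace‖ ^ 2 = H.trace.re ^ 2 + K.trace.re ^ 2 := by
    rw [← hsplit _ _ (htr hH) (htr hK), hMHK, Matrix.trace_add, Matrix.trace_smul, smul_eq_mul]
  have h2 : (H * H).trace.re + (K * K).trace.re = Fintype.card ι := by
    have hMM : M * M.conjTranspose = 1 := Unitary.mul_star_self_of_mem hM
    have hMM' : M.conjTranspose * M = 1 := Unitary.star_mul_self_of_mem hM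
    have : H * H + K * K = 1 := by
      rw [hHdef, hKdef, smul_mul_smul_comm, smul_mul_smul_comm,
        show (-Complex.I / 2) * (-Complex.I / 2) = -(1 / 2 * (1 / 2) : ℂ) by
          rw [div_mul_div_comm, neg_mul_neg, Complex.I_mul_I]; norm_num,
        neg_smul, ← sub_eq_add_neg, ← smul_sub]
      have : (M + M.conjTranspose) * (M + M.conjTranspose) -
          (M - M.conjTranspose) * (M - M.conjTranspose) = (4 : ℂ) • 1 := by
        have e : (M + M.conjTranspose) * (M + M.conjTranspose) -
          (M - M.conjTranspose) * (M - M.conjTranspose) =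
            (M * M.conjTranspose + M.conjTranspose * M) +
            (M * M.conjTranspose + M.conjTranspose * M) := by noncomm_ring
        rw [e, hMM, hMM', ← two_smul ℂ, ← two_smul ℂ, smul_smul]
        norm_num
      rw [this, smul_smul]
      norm_num
    rw [← Complex.add_re, ← Matrix.trace_add, this, Matrix.trace_one]
    simp
  simp only [hψ]
  rw [integral_add (hint H) (hint K), integral_expectation_sq hH, integral_expectation_sq hK, h1,
    ← h2]
  ring

end Haar

/-- The average gate fidelity in terms of the Hilbert-Schmidt test. -/
theorem avgGateFidelity_eq {S : Finset ℕ} {U V : Op S}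
    (hU : U ∈ Matrix.unitaryGroup (Config S) ℂ) (hV : V ∈ Matrix.unitaryGroup (Config S) ℂ) :
    avgGateFidelity U V = 1 - (2 : ℝ) ^ S.card / ((2 : ℝ) ^ S.card + 1) * costHST U V := by
  have hM : U.conjTranspose * V ∈ Matrix.unitaryGroup (Config S) ℂ :=
    mul_mem (Unitary.star_mem hU) hV
  have h := integral_norm_expectation_sq hM
  have e : avgGateFidelity U V = _ := h
  rw [e, costHST, card_config]
  push_cast
  have h4 : (4 : ℝ) ^ S.card = 2 ^ S.card * 2 ^ S.card := by rw [← mul_pow]; norm_num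
  rw [h4]
  have h2 : (0 : ℝ) < 2 ^ S.card := by positivity
  field_simp
  ring

/-! ### Light cones of brickwork circuits -/

/-- A two-qubit gate together with its position: it acts on the sites `a` and `a + 1`. -/
abbrev Gate : Type := Σ a : ℕ, Op {a, a + 1}

/-- The sites on which a gate acts. -/
abbrev Gate.support (g : Gate) : Finset ℕ := {g.1, g.1 + 1}

/-- The inverse of a unitary gate. -/
def Gate.dagger (g : Gate) : Gate := ⟨g.1, g.2.conjTranspose⟩

/-- The gate as an operator on `S`, left out unless it is supported in `S` and in `D`. -/
noncomputable def gateIn (S D : Finset ℕ) (g : Gate) : Op S :=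
  if h : g.support ⊆ S ∧ g.support ⊆ D then embed h.1 g.2 else 1

/-- The ordered product of the gates of a list that are supported in `S` and in `D`. -/
noncomputable def layerIn (S D : Finset ℕ) (gs : List Gate) : Op S :=
  (gs.map (gateIn S D)).prod

/-- The ordered product of layers, keeping the gates supported in `S` and in `D`. -/
noncomputable def circuitIn (S D : Finset ℕ) (ls : List (List Gate)) : Op S :=
  (ls.map (layerIn S D)).prod

/-- The gates of the list are unitary and act on mutually disjoint pairs of sites. -/
structure IsLayer (gs : List Gate) : Prop where
  unitary : ∀ g ∈ gs, g.2 ∈ Matrix.unitaryGroup (Config g.support) ℂ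
  disjoint : gs.Pairwise fun g g' => Disjoint g.support g'.support

theorem heisenberg_mul {S : Finset ℕ} (U V A : Op S) :
    heisenberg (U * V) A = heisenberg V (heisenberg U A) := by
  simp only [heisenberg, Matrix.conjTranspose_mul, mul_assoc]

theorem heisenberg_of_commute {S : Finset ℕ} {U A : Op S}
    (hU : U ∈ Matrix.unitaryGroup (Config S) ℂ) (h : Commute U A) : heisenberg U A = A := by
  have h1 : U.conjTranspose * U = 1 := Unitary.star_mul_self_of_mem hU
  rw [heisenberg, mul_assoc, ← h.eq, ← mul_assoc, h1, one_mul]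

theorem embed_mem_unitaryGroup {X S : Finset ℕ} (h : X ⊆ S) {A : Op X}
    (hA : A ∈ Matrix.unitaryGroup (Config X) ℂ) :
    embed h A ∈ Matrix.unitaryGroup (Config S) ℂ :=
  Unitary.map_mem (embedHom h) hA

theorem gateIn_mem_unitaryGroup {S D : Finset ℕ} {g : Gate}
    (hg : g.2 ∈ Matrix.unitaryGroup (Config g.support) ℂ) :
    gateIn S D g ∈ Matrix.unitaryGroup (Config S) ℂ := by
  unfold gateIn
  split_ifs with h
  · exact embed_mem_unitaryGroup _ hg
  · exact one_mem _

theorem gateIn_commute {S D Y : Finset ℕ} {g : Gate} {A : Op S} (hA : SupportedOn Y A)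
    (h : Disjoint g.support Y) : Commute (gateIn S D g) A := by
  unfold gateIn
  split_ifs with h'
  · exact (supportedOn_embed h'.1 g.2).commute hA h
  · exact Commute.one_left _

theorem supportedOn_one {S D : Finset ℕ} (hD : D ⊆ S) : SupportedOn D (1 : Op S) :=
  ⟨hD, 1, (embed_one _).symm⟩

theorem supportedOn_list_prod {S D : Finset ℕ} (hD : D ⊆ S) {l : List (Op S)}
    (hl : ∀ A ∈ l, SupportedOn D A) : SupportedOn D l.prod := by
  induction l with
  | nil => exact supportedOn_one hD
  | cons A l ih =>
    rw [List.prod_cons]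
    exact (hl A List.mem_cons_self).mul (ih fun B hB => hl B (List.mem_cons_of_mem _ hB))

theorem supportedOn_layerIn {S D : Finset ℕ} (hD : D ⊆ S) (gs : List Gate) :
    SupportedOn D (layerIn S D gs) := by
  refine supportedOn_list_prod hD fun A hA => ?_
  obtain ⟨g, -, rfl⟩ := List.mem_map.1 hA
  unfold gateIn
  split_ifs with h
  · exact (supportedOn_embed h.1 g.2).mono h.2 hD
  · exact supportedOn_one hD

theorem SupportedOn.heisenberg {S D : Finset ℕ} {U A : Op S} (hU : SupportedOn D U)
    (hA : SupportedOn D A) : SupportedOn D (heisenberg U A) :=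
  (hU.conjTranspose.mul hA).mul hU

/-- In the Heisenberg picture, the gates of a layer that do not touch the support `Y` of `A`
drop out, hence so may all the gates outside of any region `D` which contains the others. -/
theorem heisenberg_layerIn_eq {S D : Finset ℕ} {gs : List Gate} (hgs : IsLayer gs) :
    ∀ {Y : Finset ℕ} {A : Op S}, SupportedOn Y A →
      (∀ g ∈ gs, g.support ⊆ S → ¬ Disjoint g.support Y → g.support ⊆ D) →
      heisenberg (layerIn S S gs) A = heisenberg (layerIn S D gs) A := by
  induction gs with
  | nil => intros; rfl
  | cons g gs ih =>
    intro Y A hA hD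
    obtain ⟨hdisj, hpair⟩ := List.pairwise_cons.1 hgs.disjoint
    have hgs' : IsLayer gs := ⟨fun g' h => hgs.unitary g' (List.mem_cons_of_mem _ h), hpair⟩
    have hug := hgs.unitary g List.mem_cons_self
    simp only [layerIn, List.map_cons, List.prod_cons, heisenberg_mul]
    by_cases hd : Disjoint g.support Y
    · rw [heisenberg_of_commute (gateIn_mem_unitaryGroup hug) (gateIn_commute hA hd),
        heisenberg_of_commute (gateIn_mem_unitaryGroup hug) (gateIn_commute hA hd)]
      exact ih hgs' hA fun g' h => hD g' (List.mem_cons_of_mem _ h)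
    by_cases hS : g.support ⊆ S
    · have hgD := hD g List.mem_cons_self hS hd
      have e : gateIn S S g = embed hS g.2 := dif_pos ⟨hS, hS⟩
      have e' : gateIn S D g = embed hS g.2 := dif_pos ⟨hS, hgD⟩
      rw [e, e']
      have hYS : Y ∪ g.support ⊆ S := Finset.union_subset hA.subset hS
      refine ih hgs' (Y := Y ∪ g.support)
        (((supportedOn_embed hS g.2).mono Finset.subset_union_right hYS).heisenberg
          (hA.mono Finset.subset_union_left hYS)) fun g' h hS' hY => ?_
      refine hD g' (List.mem_cons_of_mem _ h) hS' fun h' => hY ?_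
      exact Finset.disjoint_union_right.2 ⟨h', (hdisj g' h).symm⟩
    · have e : gateIn S S g = 1 := dif_neg fun h => hS h.1
      have e' : gateIn S D g = 1 := dif_neg fun h => hS h.1
      rw [e, e']
      have h1 : heisenberg 1 A = A := by simp [heisenberg]
      rw [h1]
      exact ih hgs' hA fun g' h => hD g' (List.mem_cons_of_mem _ h)

theorem mem_domain {L : ℕ} {ℓ : ℝ} {j x : ℕ} :
    x ∈ domain L ℓ j ↔ x ∈ lattice L ∧ siteDist j x ≤ ℓ / 2 := by
  unfold domain
  rw [Finset.mem_filter]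

theorem support_subset_domain {L : ℕ} {ℓ : ℝ} {j : ℕ} {g : Gate} (hg : g.support ⊆ lattice L)
    (h : ¬ Disjoint g.support (domain L ℓ j)) : g.support ⊆ domain L (ℓ + 2) j := by
  obtain ⟨x, hx, hxD⟩ := Finset.not_disjoint_iff.1 h
  intro y hy
  refine mem_domain.2 ⟨hg hy, ?_⟩
  have h1 := (mem_domain.1 hxD).2
  have h2 := siteDist_triangle j x y
  have h3 : siteDist x y ≤ 1 := by
    simp only [Finset.mem_insert, Finset.mem_singleton] at hx hy
    unfold siteDist
    rcases hx with rfl | rfl <;> rcases hy with rfl | rfl <;> simp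
  linarith

/-- Each layer enlarges the light cone by at most one site on either side; as long as the light
cone stays inside the domain of size `R`, the gates outside of this domain drop out. -/
theorem heisenberg_circuitIn_eq {L j : ℕ} {R : ℝ} {ls : List (List Gate)}
    (hls : ∀ gs ∈ ls, IsLayer gs) : ∀ {ℓ : ℝ} {A : Op (lattice L)},
      SupportedOn (domain L ℓ j) A → ℓ + 2 * ls.length ≤ R →
      heisenberg (circuitIn (lattice L) (lattice L) ls) A =
        heisenberg (circuitIn (lattice L) (domain L R j) ls) A := by
  induction ls with
  | nil => intros; rfl
  | cons gs ls ih =>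
    intro ℓ A hA hR
    simp only [List.length_cons, Nat.cast_add, Nat.cast_one] at hR
    have hgs := hls gs List.mem_cons_self
    simp only [circuitIn, List.map_cons, List.prod_cons, heisenberg_mul]
    have hstep : ∀ {ℓ' : ℝ}, ℓ + 2 ≤ ℓ' →
        heisenberg (layerIn (lattice L) (lattice L) gs) A =
          heisenberg (layerIn (lattice L) (domain L ℓ' j) gs) A := fun h =>
      heisenberg_layerIn_eq hgs hA fun g _ hS hd =>
        (support_subset_domain hS hd).trans (domain_mono L h j)
    have hlen : (0 : ℝ) ≤ ls.length := by positivity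
    rw [← hstep (ℓ' := R) (by linarith)]
    refine ih (fun gs h => hls gs (List.mem_cons_of_mem _ h)) (ℓ := ℓ + 2) ?_ (by linarith)
    rw [hstep le_rfl]
    exact (supportedOn_layerIn (domain_subset _ _ _) gs).heisenberg
      (hA.mono (domain_mono L (by linarith) j) (domain_subset _ _ _))

/-- The circuit run backwards. -/
def reverseCircuit (ls : List (List Gate)) : List (List Gate) :=
  (ls.map fun gs => (gs.map Gate.dagger).reverse).reverse

theorem gateIn_dagger (S D : Finset ℕ) (g : Gate) :
    gateIn S D g.dagger = (gateIn S D g).conjTranspose := by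
  by_cases h : g.support ⊆ S ∧ g.support ⊆ D
  · have e : gateIn S D g = embed h.1 g.2 := dif_pos h
    have e' : gateIn S D g.dagger = embed h.1 g.2.conjTranspose := dif_pos h
    rw [e, e', embed_conjTranspose]
  · have e : gateIn S D g = 1 := dif_neg h
    have e' : gateIn S D g.dagger = 1 := dif_neg h
    rw [e, e', Matrix.conjTranspose_one]

theorem circuitIn_reverseCircuit (S D : Finset ℕ) (ls : List (List Gate)) :
    circuitIn S D (reverseCircuit ls) = (circuitIn S D ls).conjTranspose := by
  have hlayer : ∀ gs : List Gate, layerIn S D (gs.map Gate.dagger).reverse =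
      (layerIn S D gs).conjTranspose := fun gs => by
    rw [layerIn, layerIn, Matrix.conjTranspose_list_prod, List.map_reverse, List.map_map,
      List.map_map]
    congr 3
    funext g
    exact gateIn_dagger S D g
  rw [circuitIn, circuitIn, Matrix.conjTranspose_list_prod, reverseCircuit, List.map_reverse,
    List.map_map, List.map_map]
  congr 3
  funext gs
  exact hlayer gs

theorem IsLayer.reverse_dagger {gs : List Gate} (h : IsLayer gs) :
    IsLayer (gs.map Gate.dagger).reverse where
  unitary g hg := by
    obtain ⟨g', hg', rfl⟩ := List.mem_map.1 (List.mem_reverse.1 hg)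
    exact Unitary.star_mem (h.unitary g' hg')
  disjoint := by
    rw [List.pairwise_reverse, List.pairwise_map]
    exact h.disjoint.imp fun h => h.symm

/-- Moves the evolution from one operator to the other, where it runs backwards. -/
theorem normTrace_mul_heisenberg {S : Finset ℕ} (A U Q : Op S) :
    normTrace (A * (heisenberg U Q).conjTranspose) =
      normTrace (heisenberg U.conjTranspose A * Q.conjTranspose) := by
  have h : A * (heisenberg U Q).conjTranspose =
      (A * U.conjTranspose * Q.conjTranspose) * U := by
    simp only [heisenberg, Matrix.conjTranspose_mul, Matrix.conjTranspose_conjTranspose, mul_assoc]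
  rw [h, normTrace_mul_comm]
  simp only [heisenberg, Matrix.conjTranspose_conjTranspose, mul_assoc]

/-- Two light cones: in the overlap of `A`, supported in the domain of size `ℓ`, with an operator
`P` at the center evolved by a circuit, all the gates outside of the domain of size `R` may
be left out if `m` layers do not carry `P`, and the remaining ones (run backwards)
do not carry `A`, out of this domain. -/
theorem normTrace_mul_heisenberg_circuitIn {L j : ℕ} {R ℓ : ℝ} {ls : List (List Gate)}
    (hls : ∀ gs ∈ ls, IsLayer gs) {A P : Op (lattice L)} (hA : SupportedOn (domain L ℓ j) A)
    (hP : SupportedOn (domain L 0 j) P) {m : ℕ} (hm : m ≤ ls.length) (hmR : 2 * (m : ℝ) ≤ R)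
    (hR : ℓ + 2 * ((ls.length : ℝ) - m) ≤ R) :
    normTrace (A * (heisenberg (circuitIn (lattice L) (lattice L) ls) P).conjTranspose) =
      normTrace (A *
        (heisenberg (circuitIn (lattice L) (domain L R j) ls) P).conjTranspose) := by
  have hsplit : ∀ D, circuitIn (lattice L) D ls =
      circuitIn (lattice L) D (ls.take m) * circuitIn (lattice L) D (ls.drop m) := fun D => by
    rw [circuitIn, circuitIn, circuitIn, ← List.prod_append, ← List.map_append,
      List.take_append_drop]
  have h1 : heisenberg (circuitIn (lattice L) (lattice L) (reverseCircuit (ls.drop m))) A =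
      heisenberg (circuitIn (lattice L) (domain L R j) (reverseCircuit (ls.drop m))) A := by
    refine heisenberg_circuitIn_eq (fun gs h => ?_) hA ?_
    · obtain ⟨gs, h', rfl⟩ := List.mem_map.1 (List.mem_reverse.1 h)
      exact (hls gs (List.mem_of_mem_drop h')).reverse_dagger
    · rw [reverseCircuit, List.length_reverse, List.length_map, List.length_drop,
        Nat.cast_sub hm]
      exact hR
  have h2 : heisenberg (circuitIn (lattice L) (lattice L) (ls.take m)) P =
      heisenberg (circuitIn (lattice L) (domain L R j) (ls.take m)) P := by
    refine heisenberg_circuitIn_eq (fun gs h => hls gs (List.mem_of_mem_take h)) hP ?_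
    rw [List.length_take, min_eq_left hm, zero_add]
    exact hmR
  rw [hsplit, hsplit, heisenberg_mul, heisenberg_mul, h2, normTrace_mul_heisenberg A,
    normTrace_mul_heisenberg A, ← circuitIn_reverseCircuit, ← circuitIn_reverseCircuit, h1]

/-! ### The brickwork ansatz as a circuit -/

section Ansatz

variable {P : Type*}

/-- The `2 d` layers of the brickwork ansatz. -/
def ansatzLayers (V : (a : ℕ) → P → Op {a, a + 1}) (L d : ℕ) (θ θ' : Fin d → ℕ → P) :
    List (List Gate) :=
  (List.finRange d).flatMap fun i =>
    [(List.range' 1 L).map fun k => ⟨2 * k, V (2 * k) (θ i k)⟩,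
      (List.range' 1 L).map fun k => ⟨2 * k - 1, V (2 * k - 1) (θ' i k)⟩]

theorem length_ansatzLayers (V : (a : ℕ) → P → Op {a, a + 1}) (L d : ℕ) (θ θ' : Fin d → ℕ → P) :
    (ansatzLayers V L d θ θ').length = 2 * d := by
  simp [ansatzLayers, List.length_flatMap, mul_comm]

theorem isLayer_of_mem_ansatzLayers {V : (a : ℕ) → P → Op {a, a + 1}} {L d : ℕ}
    {θ θ' : Fin d → ℕ → P} (hV : ∀ a p, V a p ∈ Matrix.unitaryGroup (Config {a, a + 1}) ℂ)
    {gs : List Gate} (hgs : gs ∈ ansatzLayers V L d θ θ') : IsLayer gs := by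
  obtain ⟨i, -, h⟩ := List.mem_flatMap.1 hgs
  have hp : (List.range' 1 L).Pairwise (· < ·) := List.pairwise_lt_range'
  simp only [List.mem_cons, List.not_mem_nil, or_false] at h
  rcases h with rfl | rfl
  · constructor
    · intro g hg
      obtain ⟨k, -, rfl⟩ := List.mem_map.1 hg
      exact hV _ _
    · rw [List.pairwise_map]
      refine hp.imp fun {a b} hab => ?_
      simp only [Gate.support, Finset.disjoint_left, Finset.mem_insert, Finset.mem_singleton]
      omega
  · constructor
    · intro g hg
      obtain ⟨k, -, rfl⟩ := List.mem_map.1 hg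
      exact hV _ _
    · rw [List.pairwise_map]
      refine hp.imp_of_mem fun {a b} ha hb hab => ?_
      have := (List.mem_range'_1.1 ha).1
      simp only [Gate.support, Finset.disjoint_left, Finset.mem_insert, Finset.mem_singleton]
      omega

theorem embed_gateOn {S D : Finset ℕ} (hD : D ⊆ S) (g : Gate) :
    embed hD (gateOn D g.1 g.2) = gateIn S D g := by
  by_cases h : g.support ⊆ D
  · have e : gateOn D g.1 g.2 = embed h g.2 := dif_pos h
    have e' : gateIn S D g = embed (h.trans hD) g.2 := dif_pos ⟨h.trans hD, h⟩
    rw [e, e', embed_embed]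
  · have e : gateOn D g.1 g.2 = 1 := dif_neg h
    have e' : gateIn S D g = 1 := dif_neg fun h' => h h'.2
    rw [e, e', embed_one]

/-- The ansatz on a region `D ⊆ S`, as an operator on `S`. -/
theorem embed_ansatz {S D : Finset ℕ} (hD : D ⊆ S) (V : (a : ℕ) → P → Op {a, a + 1}) (L d : ℕ)
    (θ θ' : Fin d → ℕ → P) :
    embed hD (ansatz V L d θ θ' D) = circuitIn S D (ansatzLayers V L d θ θ') := by
  have hlayer : ∀ (f : ℕ → Gate), embedHom hD
      ((List.range' 1 L).map fun k => gateOn D (f k).1 (f k).2).prod =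
      layerIn S D ((List.range' 1 L).map f) := fun f => by
    rw [map_list_prod, layerIn, List.map_map, List.map_map]
    congr 2
    funext k
    exact embed_gateOn hD (f k)
  rw [← embedHom_apply, ansatz, map_list_prod, ansatzLayers, circuitIn, List.map_flatMap,
    List.map_map]
  rw [List.flatMap, List.prod_flatten, List.map_map]
  congr 2
  funext i
  simp only [Function.comp_apply, map_mul, List.map_cons, List.map_nil, List.prod_cons,
    List.prod_nil, mul_one]
  exact congrArg₂ (· * ·) (hlayer fun k => ⟨2 * k, V (2 * k) (θ i k)⟩)
    (hlayer fun k => ⟨2 * k - 1, V (2 * k - 1) (θ' i k)⟩)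

theorem ansatz_eq_circuitIn {S : Finset ℕ} (V : (a : ℕ) → P → Op {a, a + 1}) (L d : ℕ)
    (θ θ' : Fin d → ℕ → P) :
    ansatz V L d θ θ' S = circuitIn S S (ansatzLayers V L d θ θ') := by
  rw [← embed_ansatz (Finset.Subset.refl S), embed_self]

end Ansatz

theorem circuitIn_mem_unitaryGroup {S D : Finset ℕ} {ls : List (List Gate)}
    (hls : ∀ gs ∈ ls, IsLayer gs) : circuitIn S D ls ∈ Matrix.unitaryGroup (Config S) ℂ := by
  refine Submonoid.list_prod_mem _ fun A hA => ?_
  obtain ⟨gs, hgs, rfl⟩ := List.mem_map.1 hA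
  refine Submonoid.list_prod_mem _ fun B hB => ?_
  obtain ⟨g, hg, rfl⟩ := List.mem_map.1 hB
  exact gateIn_mem_unitaryGroup ((hls gs hgs).unitary g hg)

/-! ### Local Hamiltonians as families of local terms -/

section Hamiltonian

variable {Λ : Finset ℕ} {g dH : ℝ} {k : ℕ} {h : (X : Finset ℕ) → Op X}

/-- The term `h_X` as an operator on `Λ`. -/
noncomputable def termOn (Λ : Finset ℕ) (h : (X : Finset ℕ) → Op X) (X : Finset ℕ) : Op Λ :=
  if hX : X ⊆ Λ then embed hX (h X) else 0

open scoped Classical in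
/-- The regions `X ⊆ Λ` carrying a non-zero term. -/
noncomputable def activeRegions (Λ : Finset ℕ) (h : (X : Finset ℕ) → Op X) :
    Finset (Finset ℕ) :=
  Λ.powerset.filter fun X => termOn Λ h X ≠ 0

theorem mem_activeRegions {X : Finset ℕ} :
    X ∈ activeRegions Λ h ↔ X ⊆ Λ ∧ termOn Λ h X ≠ 0 := by
  unfold activeRegions
  rw [Finset.mem_filter, Finset.mem_powerset]

theorem termOn_of_subset {X : Finset ℕ} (hX : X ⊆ Λ) : termOn Λ h X = embed hX (h X) := dif_pos hX

theorem ne_zero_of_mem_activeRegions {X : Finset ℕ} (hX : X ∈ activeRegions Λ h) : h X ≠ 0 := by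
  obtain ⟨h1, h2⟩ := mem_activeRegions.1 hX
  intro h0
  rw [termOn_of_subset h1, h0] at h2
  exact h2 (map_zero (embedHom h1))

/-- One is added to the number of sites so that it also bounds the size of single sites. -/
theorem IsLocalHamiltonian.localTerms (hh : IsLocalHamiltonian Λ g k dH h) :
    LocalTerms (activeRegions Λ h) (termOn Λ h) g (k + 1) dH where
  selfAdjoint X hX := by
    have hX' := (mem_activeRegions.1 hX).1
    rw [termOn_of_subset hX', IsSelfAdjoint, Matrix.star_eq_conjTranspose, ← embed_conjTranspose,
      hh.hermitian X hX']
  supported X hX := by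
    rw [termOn_of_subset (mem_activeRegions.1 hX).1]
    exact supportedOn_embed _ _
  extensive x hx := by
    refine le_trans ?_ (hh.extensive x hx)
    refine (Finset.sum_le_sum fun X hX => ?_).trans
      (Finset.sum_le_sum_of_subset_of_nonneg (f := fun X => ‖h X‖) (fun X hX => ?_)
        fun _ _ _ => norm_nonneg _)
    · rw [termOn_of_subset (mem_activeRegions.1 (Finset.mem_filter.1 hX).1).1]
      exact norm_embed_le _ _
    · obtain ⟨h1, h2⟩ := Finset.mem_filter.1 hX
      exact Finset.mem_filter.2 ⟨Finset.mem_powerset.2 (mem_activeRegions.1 h1).1, h2⟩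
  card_le X hX := by
    by_contra hlt
    exact ne_zero_of_mem_activeRegions hX
      (hh.local_terms X (mem_activeRegions.1 hX).1 (by omega))
  dist_le X hX x hx y hy := by
    by_contra hlt
    exact ne_zero_of_mem_activeRegions hX
      (hh.finite_range X (mem_activeRegions.1 hX).1 ⟨x, hx, y, hy, not_le.1 hlt⟩)

/-- The Hamiltonian of a subregion `D`, as an operator on `Λ`, consists of the terms inside `D`. -/
theorem embed_hamiltonian {D : Finset ℕ} (hD : D ⊆ Λ) :
    embed hD (hamiltonian h D) = ∑ X ∈ activeRegions Λ h with X ⊆ D, termOn Λ h X := by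
  have h1 : ∑ X ∈ activeRegions Λ h with X ⊆ D, termOn Λ h X =
      ∑ X ∈ D.powerset, termOn Λ h X := by
    refine Finset.sum_subset (fun X hX => Finset.mem_powerset.2 (Finset.mem_filter.1 hX).2)
      fun X hX hX' => ?_
    by_contra h0
    have hXD := Finset.mem_powerset.1 hX
    exact hX' (Finset.mem_filter.2 ⟨mem_activeRegions.2 ⟨hXD.trans hD, h0⟩, hXD⟩)
  rw [h1, ← Finset.sum_attach, ← embedHom_apply, hamiltonian, map_sum]
  refine Finset.sum_congr rfl fun X _ => ?_
  have hXD := Finset.mem_powerset.1 X.2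
  rw [embedHom_apply, embed_embed, termOn_of_subset (hXD.trans hD)]

theorem hamiltonian_eq_sum :
    hamiltonian h Λ = ∑ X ∈ activeRegions Λ h, termOn Λ h X := by
  rw [← embed_self (Finset.Subset.refl Λ) (hamiltonian h Λ), embed_hamiltonian]
  congr 1
  exact Finset.filter_true_of_mem fun X hX => (mem_activeRegions.1 hX).1

theorem evolution_eq_propagator (S : Finset ℕ) (τ : ℝ) :
    evolution h S τ = propagator (hamiltonian h S) τ := rfl

theorem embed_propagator {X S : Finset ℕ} (hX : X ⊆ S) (H : Op X) (τ : ℝ) :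
    embed hX (propagator H τ) = propagator (embed hX H) τ := by
  have hc : Continuous (embedHom hX) :=
    LinearMap.continuous_of_finiteDimensional (embedHom hX).toAlgHom.toLinearMap
  unfold propagator
  let _ : NormedAlgebra ℚ (Op X) := NormedAlgebra.restrictScalars ℚ ℂ (Op X)
  rw [← embedHom_apply, NormedSpace.map_exp (embedHom hX) hc, map_smul]
  rfl

theorem evolution_mem_unitaryGroup (hh : IsLocalHamiltonian Λ g k dH h) {D : Finset ℕ}
    (hD : D ⊆ Λ) (τ : ℝ) : evolution h D τ ∈ Matrix.unitaryGroup (Config D) ℂ := by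
  refine propagator_mem_unitary ?_ τ
  rw [IsSelfAdjoint, hamiltonian, star_sum]
  refine Finset.sum_congr rfl fun X _ => ?_
  have hX := Finset.mem_powerset.1 X.2
  rw [Matrix.star_eq_conjTranspose, ← embed_conjTranspose, hh.hermitian X (hX.trans hD)]

end Hamiltonian

/-- The Lieb-Robinson error in closed form. -/
theorem epsLR_eq {C' v ξ τ dH L' : ℝ} (hξ : 0 < ξ) :
    epsLR C' v ξ τ dH L' = C' * (ξ * Real.exp (-(L' / 2 - dH - v * τ) / ξ)) := by
  have h1 : ∀ x : ℝ, Real.exp (-(x - v * τ) / ξ) =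
      Real.exp (v * τ / ξ) * Real.exp (-ξ⁻¹ * x) := fun x => by
    rw [← Real.exp_add]
    congr 1
    field_simp
    ring
  unfold epsLR
  simp only [h1]
  rw [MeasureTheory.integral_const_mul, integral_exp_mul_Ioi (by simpa using hξ)]
  field_simp

/-! ### Local compilation -/

section Compilation

variable {P : Type*} {g dH τ L' : ℝ} {k L d Lt : ℕ} {h : (X : Finset ℕ) → Op X}
  {V : (a : ℕ) → P → Op {a, a + 1}} {θ θ' : Fin d → ℕ → P}

/-- The local cost on a subregion `D` is the local cost of the embedded operators. -/
theorem costLHSTAt_embed {S D : Finset ℕ} (hD : D ⊆ S) {j : ℕ} (hj : j ∈ D) (U W : Op D) :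
    costLHSTAt ⟨j, hD hj⟩ (embed hD U) (embed hD W) = costLHSTAt ⟨j, hj⟩ U W := by
  have e : ∀ (Y : Op D) (a : Fin 4),
      heisenberg (embed hD Y) (embed (singleton_subset_of_mem ⟨j, hD hj⟩) (pauliSite j a)) =
      embed hD (heisenberg Y (embed (singleton_subset_of_mem ⟨j, hj⟩) (pauliSite j a))) := by
    intro Y a
    rw [heisenberg, heisenberg, embed_mul, embed_mul, embed_conjTranspose, embed_embed]
  rw [costLHSTAt_eq, costLHSTAt_eq]
  simp only [e, ← embed_conjTranspose, ← embed_mul, normTrace_embed]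

/-- A domain of real size reaches no farther than its integer radius. -/
theorem domain_subset_floor (L : ℕ) (ℓ : ℝ) (j : ℕ) :
    domain L ℓ j ⊆ domain L (2 * (⌊ℓ / 2⌋₊ : ℝ)) j := by
  intro x hx
  obtain ⟨h1, h2⟩ := mem_domain.1 hx
  refine mem_domain.2 ⟨h1, ?_⟩
  have h3 : siteDist j x = (((j : ℤ) - x).natAbs : ℕ) := by
    rw [Nat.cast_natAbs, siteDist]
    push_cast
    rfl
  rw [h3] at h2 ⊢
  have h5 : ((((j : ℤ) - x).natAbs : ℕ) : ℝ) ≤ ⌊ℓ / 2⌋₊ := by exact_mod_cast Nat.le_floor h2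
  linarith

/-- The gates outside of the domain of size `L̃` do not contribute to the local cost. Of the `2 d`
layers, the first `min(2 d, ⌊L̃ / 2⌋)` are treated by the light cone of the Pauli operators,
the others by the light cone of the evolved Pauli operators, whose domain has the
integer radius `⌊L' / 2⌋`. -/
theorem costLHSTAt_ansatz_eq (hL' : 0 ≤ L') {d' : ℝ} (hd' : 0 ≤ d') (hd : (d : ℝ) = L' / 4 + d')
    (hLt : L' + 2 * d' + 1 ≤ (Lt : ℝ))
    (hV : ∀ a p, V a p ∈ Matrix.unitaryGroup (Config {a, a + 1}) ℂ) (j : lattice L) :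
    costLHSTAt j (restrictedEvolution h L L' j τ (domain_subset L L' j))
        (ansatz V L d θ θ' (lattice L)) =
      costLHSTAt (⟨j, mem_domain_self Lt j⟩ : domain L (Lt : ℝ) j)
        (restrictedEvolution h L L' j τ (domain_mono L (size_le hd' hLt) j))
        (ansatz V L d θ θ' (domain L (Lt : ℝ) j)) := by
  have hD := domain_subset L (Lt : ℝ) j
  rw [← costLHSTAt_embed hD, embed_ansatz, ansatz_eq_circuitIn]
  have hU : embed hD (restrictedEvolution h L L' j τ (domain_mono L (size_le hd' hLt) j)) =
      restrictedEvolution h L L' j τ (domain_subset L L' j) := embed_embed _ _ _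
  rw [hU, costLHSTAt_eq, costLHSTAt_eq]
  refine congrArg (fun x : ℝ => 1 - x) (Finset.sum_congr rfl fun a _ =>
    congrArg (fun z : ℂ => 1 / 4 * z.re) ?_)
  obtain ⟨r, hr⟩ : ∃ r, r = ⌊L' / 2⌋₊ := ⟨_, rfl⟩
  have hr1 : (r : ℝ) ≤ L' / 2 := hr ▸ Nat.floor_le (by linarith)
  have hj0 : {(j : ℕ)} ⊆ domain L 0 j := by
    rw [Finset.singleton_subset_iff, mem_domain]
    exact ⟨j.2, by rw [siteDist_self]; norm_num⟩
  have hP : SupportedOn (domain L 0 j) (embed (singleton_subset_of_mem j) (pauliSite j a)) :=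
    (supportedOn_embed _ _).mono hj0 (domain_subset _ _ _)
  have hdom : domain L L' j ⊆ domain L (2 * (r : ℝ)) j := hr ▸ domain_subset_floor L L' j
  have hA : SupportedOn (domain L (2 * (r : ℝ)) j)
      (heisenberg (restrictedEvolution h L L' j τ (domain_subset L L' j))
        (embed (singleton_subset_of_mem j) (pauliSite j a))) :=
    ((supportedOn_embed _ _).mono hdom (domain_subset _ _ _)).heisenberg
      (hP.mono (domain_mono L (by positivity) j) (domain_subset _ _ _))
  have hlen := length_ansatzLayers V L d θ θ'
  have hnat : r + 2 * d + 1 ≤ Lt := by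
    have : (r : ℝ) + 2 * d + 1 ≤ Lt := by rw [hd]; linarith
    exact_mod_cast this
  have hnat' : 2 * r ≤ Lt := by
    have : (2 : ℝ) * r ≤ Lt := by linarith
    exact_mod_cast this
  -- This is where the additional site in `L' + 2 d' + 1 ≤ L̃` makes up for rounding `L̃ / 2`.
  obtain ⟨m, hm0, hm1, hm2⟩ :
      ∃ m, m ≤ 2 * d ∧ 2 * m ≤ Lt ∧ 2 * r + 2 * (2 * d) ≤ Lt + 2 * m := by
    refine ⟨min (2 * d) (Lt / 2), ?_, ?_, ?_⟩ <;> omega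
  have hm3 : (2 : ℝ) * r + 2 * (2 * d : ℕ) ≤ Lt + 2 * m := by exact_mod_cast hm2
  refine normTrace_mul_heisenberg_circuitIn (m := m)
    (fun gs hgs => isLayer_of_mem_ansatzLayers hV hgs) hA hP (hlen.symm ▸ hm0)
    (by exact_mod_cast hm1) ?_
  rw [hlen]
  linarith

/-- The local cost on the whole lattice exceeds the local-compilation cost by at most three quarters
of the error of restricting the Hamiltonian. -/
theorem costLHST_lattice_le (hh : IsLocalHamiltonian (lattice L) g k dH h) (hL : 1 ≤ L)
    (hL' : 0 ≤ L') {d' : ℝ} (hd' : 0 ≤ d') (hd : (d : ℝ) = L' / 4 + d')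
    (hLt : L' + 2 * d' + 1 ≤ (Lt : ℝ))
    (hV : ∀ a p, V a p ∈ Matrix.unitaryGroup (Config {a, a + 1}) ℂ) {ε : ℝ}
    (hε : ∀ (j : lattice L) (A : Op {(j : ℕ)}), A.IsHermitian → ‖A‖ = 1 →
      ‖heisenberg (evolution h (lattice L) τ) (siteOp j A) -
        heisenberg (restrictedEvolution h L L' j τ (domain_subset L L' j)) (siteOp j A)‖ ≤ ε) :
    costLHST (evolution h (lattice L) τ) (ansatz V L d θ θ' (lattice L)) ≤
      localCompilationCost h τ V L d θ θ' L' Lt (size_le hd' hLt) + 3 / 4 * ε := by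
  have hLpos : (0 : ℝ) < L := by exact_mod_cast hL
  have hcard : (lattice L).card = L := by simp
  have hW : ansatz V L d θ θ' (lattice L) ∈ Matrix.unitaryGroup (Config (lattice L)) ℂ := by
    rw [ansatz_eq_circuitIn]
    exact circuitIn_mem_unitaryGroup fun gs hgs => isLayer_of_mem_ansatzLayers hV hgs
  have hj : ∀ j : lattice L,
      costLHSTAt j (evolution h (lattice L) τ) (ansatz V L d θ θ' (lattice L)) ≤
      costLHSTAt (⟨j, mem_domain_self Lt j⟩ : domain L (Lt : ℝ) j)
        (restrictedEvolution h L L' j τ (domain_mono L (size_le hd' hLt) j))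
        (ansatz V L d θ θ' (domain L (Lt : ℝ) j)) + 3 / 4 * ε := fun j => by
    rw [← costLHSTAt_ansatz_eq hL' hd' hd hLt hV]
    exact costLHSTAt_le_add j (evolution_mem_unitaryGroup hh (Finset.Subset.refl _) τ)
      (embed_mem_unitaryGroup _ (evolution_mem_unitaryGroup hh (domain_subset _ _ _) τ)) hW
      fun a => hε j (pauliSite j a) (pauliSite_isHermitian _ _) (norm_pauliSite _ _)
  rw [costLHST, localCompilationCost, hcard]
  calc _ ≤ (1 / (L : ℝ)) * ∑ j : lattice L, _ :=
        mul_le_mul_of_nonneg_left (Finset.sum_le_sum fun j _ => hj j) (by positivity)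
    _ = _ := by
        rw [Finset.sum_add_distrib, mul_add, Finset.sum_const, Finset.card_univ,
          Fintype.card_coe, hcard, nsmul_eq_mul]
        congr 1
        field_simp

end Compilation

end LocalCompilation

open LocalCompilation in
theorem theorem2 (g : ℝ) (hg : 0 ≤ g) (k : ℕ) (dH : ℝ) (hdH : 0 ≤ dH) :
    -- Lieb-Robinson velocity and length, depending only on `g`, `k`, `dH`
    ∃ v ξ : ℝ, 0 < v ∧ 0 < ξ ∧ ∀ τ : ℝ, 0 ≤ τ →
    -- prefactors, depending on `τ` in addition
    ∃ C C' : ℝ, 0 < C ∧ 0 < C' ∧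
    ∀ (L : ℕ), 1 ≤ L → ∀ h : (X : Finset ℕ) → Op X,
      IsLocalHamiltonian (lattice L) g k dH h →
      -- `C`, `v`, `ξ` are constants of the Lieb-Robinson bound
      (∀ (i j : lattice L) (A : Op {(i : ℕ)}) (B : Op {(j : ℕ)}),
        A.IsHermitian → B.IsHermitian → ‖A‖ = 1 → ‖B‖ = 1 →
        ‖heisenberg (evolution h (lattice L) τ) (siteOp i A) * siteOp j B -
            siteOp j B * heisenberg (evolution h (lattice L) τ) (siteOp i A)‖ ≤
          C * Real.exp (-(siteDist i j - v * τ) / ξ)) ∧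
      ∀ l₀ : ℝ, 0 ≤ l₀ → ∀ L' : ℝ, L' = 2 * (l₀ + dH + v * τ) →
        -- `ε_LR` bounds the error made by restricting the Hamiltonian
        (∀ (j : lattice L) (A : Op {(j : ℕ)}), A.IsHermitian → ‖A‖ = 1 →
          ‖heisenberg (evolution h (lattice L) τ) (siteOp j A) -
            heisenberg (restrictedEvolution h L L' j τ (domain_subset L L' j)) (siteOp j A)‖ ≤
            epsLR C' v ξ τ dH L') ∧
        -- the local compilation for an arbitrary brickwork ansatz of depth `d = L'/4 + d'`
        ∀ (P : Type*) (V : (a : ℕ) → P → Op {a, a + 1}),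
          (∀ a p, V a p ∈ Matrix.unitaryGroup (Config {a, a + 1}) ℂ) →
        ∀ (d : ℕ) (d' : ℝ) (hd' : 0 ≤ d'), (d : ℝ) = L' / 4 + d' →
        ∀ (Lt : ℕ) (hLt : L' + 2 * d' + 1 ≤ (Lt : ℝ)) (θ θ' : Fin d → ℕ → P) (εLHST : ℝ),
          localCompilationCost h τ V L d θ θ' L' Lt (size_le hd' hLt) ≤ εLHST →
          costLHST (evolution h (lattice L) τ) (ansatz V L d θ θ' (lattice L)) ≤
              εLHST + 3 / 4 * epsLR C' v ξ τ dH L' ∧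
          costHST (evolution h (lattice L) τ) (ansatz V L d θ θ' (lattice L)) ≤
              (L : ℝ) * (εLHST + 3 / 4 * epsLR C' v ξ τ dH L') ∧
          1 - (2 : ℝ) ^ L / ((2 : ℝ) ^ L + 1) *
                ((L : ℝ) * (εLHST + 3 / 4 * epsLR C' v ξ τ dH L')) ≤
            avgGateFidelity (evolution h (lattice L) τ) (ansatz V L d θ θ' (lattice L)) := by
  obtain ⟨D, hDdef⟩ : ∃ D, D = dH + 1 := ⟨_, rfl⟩
  have hD : 0 < D := by linarith
  -- the rate of the Lieb-Robinson series
  obtain ⟨c, hc⟩ : ∃ c, c = Real.exp 1 * (2 * ((k + 1 : ℕ) : ℝ) * g) := ⟨_, rfl⟩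
  have hc0 : 0 ≤ c := by rw [hc]; positivity
  -- `v / ξ` has to dominate the rate `c`, and `v` has to be positive even if `g = 0`.
  refine ⟨c * D + 1, D, by positivity, hD, fun τ hτ => ?_⟩
  have hrate : Real.exp (Real.exp 1 * (2 * ((k + 1 : ℕ) : ℝ) * g * τ)) ≤
      Real.exp ((c * D + 1) * τ / D) := by
    rw [Real.exp_le_exp, le_div_iff₀ hD, hc]
    nlinarith
  have hexp : ∀ r : ℝ, Real.exp (-r / D) * Real.exp ((c * D + 1) * τ / D) =
      Real.exp (-(r - (c * D + 1) * τ) / D) := fun r => by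
    rw [← Real.exp_add]
    congr 1
    ring
  -- `C'` collects the factor `4 D g` from the boundary terms, the time `τ` and a factor `e`
  -- from rounding the distance; the `ξ = D` produced by the integral absorbs `D`.
  refine ⟨2 * Real.exp 1, 4 * g * Real.exp 1 * τ + 1, by positivity, by positivity,
    fun L hL h hh => ⟨?_, ?_⟩⟩
  · intro i j A B _ _ hA hB
    have hT := hh.localTerms
    have hH := hT.isSelfAdjoint_sum
    have key := hT.norm_lie_heisenbergEvolution_le_exp hg hdH (j := i)
      (B := siteOp i A) (supportedOn_embed _ _) (Z := {(j : ℕ)}) (A := siteOp j B)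
      (supportedOn_embed _ _) (by simp) (r := siteDist i j) (abs_nonneg _)
      (fun x hx => by rw [Finset.mem_singleton.1 hx, siteDist_comm]) hτ
    rw [← hamiltonian_eq_sum, Ring.lie_def, norm_sub_rev] at key
    refine key.trans ?_
    have hA' : ‖siteOp i A‖ ≤ 1 := (norm_embed_le _ _).trans_eq hA
    have hB' : ‖siteOp j B‖ ≤ 1 := (norm_embed_le _ _).trans_eq hB
    rw [← hDdef, ← hexp]
    calc _ ≤ 2 * 1 * (1 * (Real.exp 1 * Real.exp (-siteDist i j / D) *
          Real.exp ((c * D + 1) * τ / D))) := by gcongr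
      _ = _ := by ring
  · intro l₀ hl₀ L' hL'
    have hL'0 : 0 ≤ L' := by rw [hL']; positivity
    have hrestr : ∀ (j : lattice L) (A : Op {(j : ℕ)}), A.IsHermitian → ‖A‖ = 1 →
        ‖heisenberg (evolution h (lattice L) τ) (siteOp j A) -
          heisenberg (restrictedEvolution h L L' j τ (domain_subset L L' j)) (siteOp j A)‖ ≤
          epsLR (4 * g * Real.exp 1 * τ + 1) (c * D + 1) D τ dH L' := by
      intro j A _ hA
      have hr : 0 ≤ l₀ + (c * D + 1) * τ := by positivity
      have hdom : ∀ x, x ∈ domain L L' j ↔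
          x ∈ lattice L ∧ siteDist x j ≤ l₀ + (c * D + 1) * τ + dH := fun x => by
        rw [mem_domain, siteDist_comm, hL']
        ring_nf
      have key := hh.localTerms.norm_restriction_error_le hg hdH (j := j) (B := siteOp j A)
        (supportedOn_embed _ _) hr hdom hτ
      rw [← hamiltonian_eq_sum, ← embed_hamiltonian (domain_subset L L' j)] at key
      have e : heisenberg (restrictedEvolution h L L' j τ (domain_subset L L' j)) (siteOp j A) =
          heisenbergEvolution (embed (domain_subset L L' j) (hamiltonian h (domain L L' j))) τ
            (siteOp j A) := by
        rw [restrictedEvolution, evolution_eq_propagator, embed_propagator]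
        rfl
      rw [e]
      refine key.trans ?_
      have hA' : ‖siteOp j A‖ ≤ 1 := (norm_embed_le _ _).trans_eq hA
      rw [epsLR_eq hD, show L' / 2 - dH = l₀ + (c * D + 1) * τ by rw [hL']; ring, ← hexp,
        ← hDdef]
      calc _ ≤ 2 * (2 * D * g) * (1 * (Real.exp 1 *
            Real.exp (-(l₀ + (c * D + 1) * τ) / D) * Real.exp ((c * D + 1) * τ / D))) * τ := by
            gcongr
        _ = (4 * g * Real.exp 1 * τ) * (D * (Real.exp (-(l₀ + (c * D + 1) * τ) / D) *
            Real.exp ((c * D + 1) * τ / D))) := by ring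
        _ ≤ _ := by
            gcongr
            linarith
    refine ⟨hrestr, ?_⟩
    intro P V hV d d' hd' hd Lt hLt θ θ' εLHST hcost
    have hLpos : (0 : ℝ) < L := by exact_mod_cast hL
    have hcard : (lattice L).card = L := by simp
    have hW : ansatz V L d θ θ' (lattice L) ∈ Matrix.unitaryGroup (Config (lattice L)) ℂ := by
      rw [ansatz_eq_circuitIn]
      exact circuitIn_mem_unitaryGroup fun gs hgs => isLayer_of_mem_ansatzLayers hV hgs
    have hU := evolution_mem_unitaryGroup hh (Finset.Subset.refl _) τ
    have h1 : costLHST (evolution h (lattice L) τ) (ansatz V L d θ θ' (lattice L)) ≤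
        εLHST + 3 / 4 * epsLR (4 * g * Real.exp 1 * τ + 1) (c * D + 1) D τ dH L' :=
      (costLHST_lattice_le hh hL hL'0 hd' hd hLt hV hrestr).trans (by linarith)
    have h2 : costHST (evolution h (lattice L) τ) (ansatz V L d θ θ' (lattice L)) ≤
        L * (εLHST + 3 / 4 * epsLR (4 * g * Real.exp 1 * τ + 1) (c * D + 1) D τ dH L') := by
      refine (costHST_le_sum hU hW).trans (le_trans (le_of_eq ?_)
        (mul_le_mul_of_nonneg_left h1 hLpos.le))
      rw [costLHST, hcard, ← mul_assoc, mul_one_div_cancel hLpos.ne', one_mul]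
    refine ⟨h1, h2, ?_⟩
    rw [avgGateFidelity_eq hU hW, hcard]
    exact sub_le_sub_left (mul_le_mul_of_nonneg_left h2 (by positivity)) 1
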